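/- Let $n\ge 2$, $\alpha\in(0,1)$, and write points of $\mathbb{R}^n$ as $x=(x',x_n)$ with $x'\in\mathbb{R}^{n-1}$, $x_n\in\mathbb{R}$. Let $\mathbb{R}^n_+=\{(x',x_n): x'\in\mathbb{R}^{n-1},\ x_n>0\}$ be the upper half-space, and let $|\cdot|$ be the Euclidean norm. Let $U$ be a bounded real-valued harmonic function on $\mathbb{R}^n_+$, continuous on the closure $\overline{\mathbb{R}^n_+}$, and assume that for a constant $C$ $$|U(x',0)-U(y',0)|\le C|x'-y'|^{\alpha},\qquad x',y'\in\mathbb{R}^{n-1}.$$ Then for all $(x',x_n)\in\mathbb{R}^n_+$ $$\left|\frac{\partial U}{\partial x_n}(x',x_n)\right|\le\frac{4(n-1)^{1/2}}{1-\alpha}\,C\,x_n^{\alpha-1} \qquad\text{and}\qquad |\nabla U(x',x_n)|\le\frac{16(n+1)}{(1-\alpha)^2}\,C\,x_n^{\alpha-1}.$$ Moreover, $U$ belongs to the Lipschitz class $\Lambda^\alpha(\mathbb{R}^n_+)$ (that is, there is a constant $C'$ with $|U(x)-U(y)|\le C'|x-y|^\alpha$ for all $x,y\in\mathbb{R}^n_+$),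 and $$|U(x)-U(y)|\le\frac{64(n+1)}{\alpha(1-\alpha)^2}\,C\,|x-y|^{\alpha},\qquad x,y\in\mathbb{R}^n_+.$$ -/

import Mathlib

open scoped Gradient

namespace HalfSpace

/-- The point `(x', t)` of `ℝ^(d+1)` with `x' ∈ ℝ^d` and last coordinate `t`. -/
noncomputable def point {d : ℕ} (x' : EuclideanSpace ℝ (Fin d)) (t : ℝ) :
    EuclideanSpace ℝ (Fin (d + 1)) :=
  WithLp.toLp 2 (Fin.snoc (α := fun _ => ℝ) (fun i => x' i) t)

/-- The open upper half-space `{(x', t) : x' ∈ ℝ^d, t ∈ (0, ∞)}` of `ℝ^(d+1)`. -/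
def upperHalfSpace (d : ℕ) : Set (EuclideanSpace ℝ (Fin (d + 1))) :=
  {x | 0 < x (Fin.last d)}

/-- The Lipschitz (Hölder) class `Λ^α(E)` of functions on a set `E`. -/
def MemLipschitzClass {X F : Type*} [NormedAddCommGroup X] [NormedAddCommGroup F]
    (α : ℝ) (E : Set X) (f : X → F) : Prop :=
  ∃ C : ℝ, ∀ x ∈ E, ∀ y ∈ E, ‖f x - f y‖ ≤ C * ‖x - y‖ ^ α

end HalfSpace

/-!
The bounded harmonic function `U` is the Poisson integral of its boundary values `f`, and every
estimate is read off from this representation. Write `P_t(z) = t (|z|² + t²)^(-(d+1)/2)`, so that,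
up to a normalizing constant, `U(x', t) = ∫ P_t(z) f(x' + z) dz`, and let `κ` be the normalized
`α`-th moment of `P_1` (`cauchyMoment`), so that the one of `P_t` is `κ t^α`.

*Representation* (`eq_poissonIntegral`). The Poisson integral `F` of `f` is continuous up to the
boundary, where it equals `f`. No derivative of `F` is needed to compare it with `U`: on a compact
subset `K` of the half-space `F` is a Bochner integral, in `C(K, ℝ)`, of harmonic functions, hence a
uniform limit of harmonic functions (`exists_harmonic_approx`), and the weak maximum principle
(`le_of_le_frontier`) survives uniform limits. The contribution of infinity is absorbed by a harmonic
polynomial that is at least `1` on a half-sphere of radius `R` and tends to `0` at each point as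
`R → ∞` (`le_poissonIntegral_add`).

*Normal derivative.* As `P_t / t` decreases in `t`, for `s < t` the difference `|P_t - P_s|` is at
most `(2t/s - 1) P_s - P_t` (`abs_cauchyKernel_sub_le`). Integrating this against `|z|^α` and letting
`s → t` bounds the normal derivative by `(2 - α) κ C t^(α-1)`, and polar coordinates give
`(2 - α) κ ≤ 4 √d / (1 - α)` (`two_sub_mul_cauchyMoment_le`).

*Tangential derivatives.* A translation by `h` changes `P_t(z)` by a relative amount of about
`(d + 1) |h| / |(z, t)|`, and `|z|^α / |(z, t)| ≤ t^(α-1)`, so tangential derivatives are at most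
`(d + 1) C t^(α-1)`.

*Hölder bound.* `U(x', t)` is an average of `f(x' + t y)` over `y`, whence
`|U(x', t) - U(y', s)| ≤ C |x' - y'|^α + C κ |t - s|^α` (`abs_poissonIntegral_sub_le`).
-/

namespace HalfSpace
open Filter Topology InnerProductSpace MeasureTheory Set
open scoped Laplacian

variable {d : ℕ}

/-! ### The Laplacian, the maximum principle and the harmonic kernel -/

theorem iteratedFDeriv_two_eq_deriv_deriv {E : Type*} [NormedAddCommGroup E] [NormedSpace ℝ E]
    {u : E → ℝ} {x : E} (hu : ContDiffAt ℝ 2 u x) (v : E) :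
    iteratedFDeriv ℝ 2 u x ![v, v] = deriv (deriv fun s : ℝ => u (x + s • v)) 0 := by
  have hline : ∀ s : ℝ, HasDerivAt (fun s : ℝ => x + s • v) v s := fun s => by
    simpa using ((hasDerivAt_id s).smul_const v).const_add x
  have hev : ∀ᶠ s : ℝ in 𝓝 0, ContDiffAt ℝ 2 u (x + s • v) := by
    have h : ∀ᶠ y in 𝓝 (x + (0 : ℝ) • v), ContDiffAt ℝ 2 u y := by
      rw [zero_smul, add_zero]
      exact hu.eventually (by simp)
    exact (hline 0).continuousAt.eventually h
  have h1 : deriv (fun s : ℝ => u (x + s • v)) =ᶠ[𝓝 0] fun s => fderiv ℝ u (x + s • v) v := by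
    filter_upwards [hev] with s hs
    have hd : HasFDerivAt u (fderiv ℝ u (x + s • v)) (x + s • v) :=
      (hs.differentiableAt (by norm_num)).hasFDerivAt
    exact (hd.comp_hasDerivAt s (hline s)).deriv
  rw [h1.deriv_eq, iteratedFDeriv_two_apply]
  have h2 : DifferentiableAt ℝ (fderiv ℝ u) x :=
    (hu.fderiv_right (m := 1) (by norm_num)).differentiableAt (by norm_num)
  have h2' : HasFDerivAt (fderiv ℝ u) (fderiv ℝ (fderiv ℝ u) x) (x + (0 : ℝ) • v) := by
    simpa using h2.hasFDerivAt
  have h3 : HasDerivAt (fun s : ℝ => fderiv ℝ u (x + s • v)) (fderiv ℝ (fderiv ℝ u) x v) 0 :=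
    h2'.comp_hasDerivAt (0 : ℝ) (hline 0)
  have h4 : HasDerivAt (fun s : ℝ => fderiv ℝ u (x + s • v) v)
      (fderiv ℝ (fderiv ℝ u) x v v) 0 := by
    simpa using h3.clm_apply (hasDerivAt_const (0 : ℝ) v)
  rw [h4.deriv]
  rfl

theorem laplacian_eq_sum_deriv_deriv {n : ℕ} {u : EuclideanSpace ℝ (Fin n) → ℝ}
    {x : EuclideanSpace ℝ (Fin n)} (hu : ContDiffAt ℝ 2 u x) :
    Δ u x = ∑ i, deriv (deriv fun s : ℝ => u (x + s • EuclideanSpace.single i (1 : ℝ))) 0 := by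
  rw [laplacian_eq_iteratedFDeriv_orthonormalBasis u (EuclideanSpace.basisFun (Fin n) ℝ)]
  simp [iteratedFDeriv_two_eq_deriv_deriv hu]

theorem deriv_deriv_nonpos_of_isLocalMax {f : ℝ → ℝ} {x : ℝ} (h : IsLocalMax f x)
    (hf : ContinuousAt f x) : deriv (deriv f) x ≤ 0 := by
  by_contra! hpos
  have hmin := isLocalMin_of_deriv_deriv_pos hpos h.deriv_eq_zero hf
  have hconst : f =ᶠ[𝓝 x] fun _ => f x := by
    filter_upwards [h, hmin] with y h1 h2 using le_antisymm h1 h2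
  have : deriv f =ᶠ[𝓝 x] fun _ => 0 := by
    simpa using hconst.deriv
  rw [this.deriv_eq] at hpos
  simp at hpos

theorem laplacian_nonpos_of_isLocalMax {n : ℕ} {u : EuclideanSpace ℝ (Fin n) → ℝ}
    {x : EuclideanSpace ℝ (Fin n)} (hu : ContDiffAt ℝ 2 u x) (h : IsLocalMax u x) :
    Δ u x ≤ 0 := by
  rw [laplacian_eq_sum_deriv_deriv hu]
  refine Finset.sum_nonpos fun i _ => ?_
  have hc : ContinuousAt (fun s : ℝ => x + s • EuclideanSpace.single i (1 : ℝ)) 0 := by fun_prop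
  refine deriv_deriv_nonpos_of_isLocalMax ?_ ?_
  · have := hc.eventually (p := fun y => u y ≤ u x) (by simp only [zero_smul, add_zero]; exact h)
    simpa [IsLocalMax, IsMaxFilter] using this
  · refine ContinuousAt.comp (g := u) ?_ hc
    simpa using hu.continuousAt

theorem norm_add_smul_single_sq {n : ℕ} (x : EuclideanSpace ℝ (Fin n)) (i : Fin n) (s : ℝ) :
    ‖x + s • EuclideanSpace.single i (1 : ℝ)‖ ^ 2 = ‖x‖ ^ 2 + 2 * x i * s + s ^ 2 := by
  rw [norm_add_sq_real, inner_smul_right, norm_smul]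
  simp [EuclideanSpace.inner_single_right]
  ring

theorem deriv_deriv_quadratic (a b c : ℝ) :
    deriv (deriv fun s : ℝ => a + b * s + c * s ^ 2) 0 = 2 * c := by
  have h : deriv (fun s : ℝ => a + b * s + c * s ^ 2) = fun s => b + c * (2 * s) := by
    ext s
    have := (((hasDerivAt_id s).const_mul b).const_add a).add (((hasDerivAt_id s).pow 2).const_mul c)
    refine (this.congr_deriv ?_).deriv
    simp
  rw [h]
  have := ((((hasDerivAt_id (0 : ℝ)).const_mul 2).const_mul c).const_add b)
  refine (this.congr_deriv ?_).deriv
  ring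

theorem laplacian_quadratic (A B D : ℝ) (x : EuclideanSpace ℝ (Fin (d + 1))) :
    Δ (fun x : EuclideanSpace ℝ (Fin (d + 1)) =>
      A * ‖x‖ ^ 2 + B * x (Fin.last d) ^ 2 + D * x (Fin.last d)) x = 2 * (d + 1) * A + 2 * B := by
  have hl : ContDiff ℝ 2 fun x : EuclideanSpace ℝ (Fin (d + 1)) => x (Fin.last d) :=
    (EuclideanSpace.proj (𝕜 := ℝ) (Fin.last d)).contDiff
  rw [laplacian_eq_sum_deriv_deriv]
  · have key : ∀ i : Fin (d + 1), deriv (deriv fun s : ℝ =>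
        A * ‖x + s • EuclideanSpace.single i (1 : ℝ)‖ ^ 2
        + B * (x + s • EuclideanSpace.single i (1 : ℝ)) (Fin.last d) ^ 2
        + D * (x + s • EuclideanSpace.single i (1 : ℝ)) (Fin.last d)) 0
        = 2 * A + if i = Fin.last d then 2 * B else 0 := by
      intro i
      simp only [norm_add_smul_single_sq]
      by_cases hi : i = Fin.last d
      · subst hi
        rw [if_pos rfl, show 2 * A + 2 * B = 2 * (A + B) by ring, ← deriv_deriv_quadratic
          (A * ‖x‖ ^ 2 + B * x (Fin.last d) ^ 2 + D * x (Fin.last d))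
          (2 * A * x (Fin.last d) + 2 * B * x (Fin.last d) + D) (A + B)]
        congr 2
        ext s
        simp
        ring
      · rw [if_neg hi, add_zero, ← deriv_deriv_quadratic
          (A * ‖x‖ ^ 2 + B * x (Fin.last d) ^ 2 + D * x (Fin.last d)) (2 * A * x i) A]
        congr 2
        ext s
        simp [Ne.symm hi]
        ring
    simp only [key, Finset.sum_add_distrib]
    simp
    ring
  · exact (((contDiff_norm_sq ℝ).const_smul A).add ((hl.pow 2).const_smul B)).add
      (hl.const_smul D) |>.contDiffAt

/-- Weak maximum principle for subharmonic functions on a compact set. -/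
theorem le_of_le_frontier {K : Set (EuclideanSpace ℝ (Fin (d + 1)))} (hK : IsCompact K)
    {v : EuclideanSpace ℝ (Fin (d + 1)) → ℝ} (hc : ContinuousOn v K)
    (hv : ∀ x ∈ interior K, ContDiffAt ℝ 2 v x ∧ 0 ≤ Δ v x) {m : ℝ}
    (hm : ∀ x ∈ frontier K, v x ≤ m) : ∀ x ∈ K, v x ≤ m := by
  intro x hx
  obtain ⟨R, hR⟩ := hK.isBounded.exists_norm_le
  have hR0 : 0 ≤ R := (norm_nonneg x).trans (hR x hx)
  have key : ∀ η : ℝ, 0 < η → v x ≤ m + η * R ^ 2 := by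
    intro η hη
    -- Adding `η ‖x‖²` makes the Laplacian strictly positive, which excludes interior maxima.
    set q : EuclideanSpace ℝ (Fin (d + 1)) → ℝ := fun x =>
      η * ‖x‖ ^ 2 + 0 * x (Fin.last d) ^ 2 + 0 * x (Fin.last d) with hq
    have hqs : ∀ x, q x = η * ‖x‖ ^ 2 := fun x => by simp [hq]
    have hqc : ContDiff ℝ 2 q := by
      have : q = fun x => η • ‖x‖ ^ 2 := by ext x; simp [hq]
      rw [this]
      exact (contDiff_norm_sq ℝ).const_smul η
    obtain ⟨p, hpK, hp⟩ := hK.exists_isMaxOn ⟨x, hx⟩ (hc.add hqc.continuous.continuousOn)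
    have hpf : p ∈ frontier K := by
      by_contra hcon
      have hpi : p ∈ interior K := by
        rw [hK.isClosed.frontier_eq] at hcon
        by_contra h
        exact hcon ⟨hpK, h⟩
      have hmax : IsLocalMax (v + q) p := hp.isLocalMax (mem_interior_iff_mem_nhds.1 hpi)
      have h1 : Δ (v + q) p ≤ 0 :=
        laplacian_nonpos_of_isLocalMax ((hv p hpi).1.add hqc.contDiffAt) hmax
      rw [(hv p hpi).1.laplacian_add hqc.contDiffAt, laplacian_quadratic] at h1
      have := (hv p hpi).2
      have : 0 < 2 * ((d : ℝ) + 1) * η := by positivity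
      linarith
    have h2 : v x + q x ≤ v p + q p := hp hx
    rw [hqs, hqs] at h2
    have h3 := hm p hpf
    have h4 : ‖p‖ ^ 2 ≤ R ^ 2 := by gcongr; exact hR p hpK
    have h5 : 0 ≤ η * ‖x‖ ^ 2 := by positivity
    nlinarith
  have hlim : Tendsto (fun η : ℝ => m + η * R ^ 2) (𝓝[>] 0) (𝓝 m) := by
    have : Tendsto (fun η : ℝ => m + η * R ^ 2) (𝓝 0) (𝓝 (m + 0 * R ^ 2)) := by
      apply Continuous.tendsto; fun_prop
    simpa using this.mono_left nhdsWithin_le_nhds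
  refine ge_of_tendsto hlim ?_
  filter_upwards [self_mem_nhdsWithin] with η hη using key η hη

theorem isOpen_upperHalfSpace : IsOpen (upperHalfSpace d) :=
  isOpen_lt continuous_const (EuclideanSpace.proj (𝕜 := ℝ) (Fin.last d)).continuous

/-- The restriction of the Poisson kernel to a coordinate line has the form
`(a + b s) (q + 2 c s + s²)^γ`. -/
theorem deriv_deriv_linear_mul_rpow (a b c γ : ℝ) {q : ℝ} (hq : 0 < q) :
    deriv (deriv fun s : ℝ => (a + b * s) * (q + 2 * c * s + s ^ 2) ^ γ) 0 =
      4 * b * c * γ * q ^ (γ - 1) +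
        a * (4 * c ^ 2 * (γ * (γ - 1)) * q ^ (γ - 2) + 2 * γ * q ^ (γ - 1)) := by
  have hQ : ∀ s : ℝ, HasDerivAt (fun s : ℝ => q + 2 * c * s + s ^ 2) (2 * c + 2 * s) s := by
    intro s
    have := (((hasDerivAt_id s).const_mul (2 * c)).const_add q).add ((hasDerivAt_id s).pow 2)
    exact this.congr_deriv (by simp)
  have hA : ∀ s : ℝ, HasDerivAt (fun s : ℝ => a + b * s) b s := by
    intro s
    simpa using ((hasDerivAt_id s).const_mul b).const_add a
  have hpos : ∀ᶠ s : ℝ in 𝓝 0, 0 < q + 2 * c * s + s ^ 2 := by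
    have : ContinuousAt (fun s : ℝ => q + 2 * c * s + s ^ 2) 0 := (hQ 0).continuousAt
    exact this.eventually (lt_mem_nhds (by simpa using hq))
  have h1 : deriv (fun s : ℝ => (a + b * s) * (q + 2 * c * s + s ^ 2) ^ γ) =ᶠ[𝓝 0]
      fun s => b * (q + 2 * c * s + s ^ 2) ^ γ +
        (a + b * s) * ((2 * c + 2 * s) * γ * (q + 2 * c * s + s ^ 2) ^ (γ - 1)) := by
    filter_upwards [hpos] with s hs
    exact ((hA s).mul ((hQ s).rpow_const (Or.inl hs.ne'))).deriv
  rw [h1.deriv_eq]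
  have hL : HasDerivAt (fun s : ℝ => 2 * c + 2 * s) 2 0 := by
    simpa using ((hasDerivAt_id (0 : ℝ)).const_mul 2).const_add (2 * c)
  have hne : q + 2 * c * 0 + 0 ^ 2 ≠ 0 := by simpa using hq.ne'
  have h2 := (((hQ 0).rpow_const (p := γ) (Or.inl hne)).const_mul b).add
    ((hA 0).mul ((hL.mul_const γ).mul ((hQ 0).rpow_const (p := γ - 1) (Or.inl hne))))
  refine (h2.congr_deriv ?_).deriv
  simp only [Pi.mul_apply, mul_zero, add_zero, ne_eq, OfNat.ofNat_ne_zero, not_false_eq_true, zero_pow]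
  rw [show γ - 1 - 1 = γ - 2 by ring]
  ring

/-- The Poisson kernel of the upper half-space with pole `y`, up to a normalizing factor. It
is meant for `y` on the boundary hyperplane. -/
noncomputable def poissonKernel (y x : EuclideanSpace ℝ (Fin (d + 1))) : ℝ :=
  x (Fin.last d) * (‖x - y‖ ^ 2) ^ (-((d : ℝ) + 1) / 2)

theorem harmonicOnNhd_poissonKernel {y : EuclideanSpace ℝ (Fin (d + 1))}
    (hy : y (Fin.last d) = 0) : HarmonicOnNhd (poissonKernel y) (upperHalfSpace d) := by
  have hne : ∀ x ∈ upperHalfSpace d, 0 < ‖x - y‖ ^ 2 := by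
    intro x hx
    have : x - y ≠ 0 := by
      intro h
      have h2 : (x - y) (Fin.last d) = 0 := by rw [h]; rfl
      have hx' : 0 < x (Fin.last d) := hx
      simp [hy] at h2
      linarith
    positivity
  have hl : ContDiff ℝ 2 fun x : EuclideanSpace ℝ (Fin (d + 1)) => x (Fin.last d) :=
    (EuclideanSpace.proj (𝕜 := ℝ) (Fin.last d)).contDiff
  have hcd : ∀ x ∈ upperHalfSpace d, ContDiffAt ℝ 2 (poissonKernel y) x := by
    intro x hx
    refine hl.contDiffAt.mul (ContDiffAt.rpow_const_of_ne ?_ (hne x hx).ne')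
    exact ((contDiff_norm_sq ℝ).comp (contDiff_id.sub contDiff_const)).contDiffAt
  have hlap : ∀ x ∈ upperHalfSpace d, Δ (poissonKernel y) x = 0 := by
    intro x hx
    rw [laplacian_eq_sum_deriv_deriv (hcd x hx)]
    set γ : ℝ := -((d : ℝ) + 1) / 2 with hγ
    set q := ‖x - y‖ ^ 2 with hq
    have key : ∀ i : Fin (d + 1), deriv (deriv fun s : ℝ =>
        poissonKernel y (x + s • EuclideanSpace.single i (1 : ℝ))) 0
        = (if i = Fin.last d then 4 * x (Fin.last d) * γ * q ^ (γ - 1) else 0) +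
          x (Fin.last d) * (4 * (x - y) i ^ 2 * (γ * (γ - 1)) * q ^ (γ - 2)
            + 2 * γ * q ^ (γ - 1)) := by
      intro i
      have hfun : (fun s : ℝ => poissonKernel y (x + s • EuclideanSpace.single i (1 : ℝ))) =
          fun s : ℝ => (x (Fin.last d) + (if i = Fin.last d then 1 else 0) * s) *
            (q + 2 * (x - y) i * s + s ^ 2) ^ γ := by
        ext s
        rw [poissonKernel, add_sub_right_comm, norm_add_smul_single_sq]
        congr 1
        by_cases hi : i = Fin.last d
        · subst hi; simp
        · simp [hi, Ne.symm hi]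
      rw [hfun, deriv_deriv_linear_mul_rpow _ _ _ _ (hne x hx)]
      by_cases hi : i = Fin.last d
      · subst hi; simp [hy, q]
      · simp [hi, q]
    -- The sum is a multiple of `γ (2 γ + d + 1)`, which vanishes for `γ = -(d + 1) / 2`.
    simp only [key, Finset.sum_add_distrib, ← Finset.mul_sum, ← Finset.sum_mul]
    have hsum : ∑ i, (x - y) i ^ 2 = q := by
      rw [hq, EuclideanSpace.norm_sq_eq]; simp
    have hpow : q * q ^ (γ - 2) = q ^ (γ - 1) := by
      rw [show γ - 1 = 1 + (γ - 2) by ring, Real.rpow_add (hne x hx), Real.rpow_one]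
    rw [hsum]
    simp only [Finset.sum_ite_eq', Finset.mem_univ, if_true, Finset.sum_const, Finset.card_univ,
      Fintype.card_fin, nsmul_eq_mul]
    have : 4 * q * (γ * (γ - 1)) * q ^ (γ - 2) = 4 * (γ * (γ - 1)) * q ^ (γ - 1) := by
      rw [← hpow]; ring
    rw [this, hγ]
    push_cast
    ring
  intro x hx
  exact ⟨hcd x hx, (isOpen_upperHalfSpace.mem_nhds hx |> fun h => by
    filter_upwards [h] with z hz using hlap z hz)⟩

/-! ### Poisson integrals as uniform limits of harmonic functions -/

/-- The component `x'` of a point `x = (x', t)` of `ℝ^(d+1)`. -/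
noncomputable def tangential (x : EuclideanSpace ℝ (Fin (d + 1))) : EuclideanSpace ℝ (Fin d) :=
  WithLp.toLp 2 fun i => x i.castSucc

@[simp] theorem tangential_point (x' : EuclideanSpace ℝ (Fin d)) (t : ℝ) :
    tangential (point x' t) = x' := by
  ext i; simp [tangential, point]

@[simp] theorem point_last (x' : EuclideanSpace ℝ (Fin d)) (t : ℝ) :
    point x' t (Fin.last d) = t := by
  simp [point]

@[simp] theorem point_tangential (x : EuclideanSpace ℝ (Fin (d + 1))) :
    point (tangential x) (x (Fin.last d)) = x := by
  ext i
  refine Fin.lastCases ?_ (fun j => ?_) i <;> simp [tangential, point]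

theorem norm_sq_eq (x : EuclideanSpace ℝ (Fin (d + 1))) :
    ‖x‖ ^ 2 = ‖tangential x‖ ^ 2 + x (Fin.last d) ^ 2 := by
  simp [EuclideanSpace.norm_sq_eq, Fin.sum_univ_castSucc, tangential]

theorem tangential_sub (x y : EuclideanSpace ℝ (Fin (d + 1))) :
    tangential (x - y) = tangential x - tangential y := by
  ext i; simp [tangential]

theorem continuous_tangential : Continuous (tangential (d := d)) := by
  unfold tangential
  fun_prop

theorem continuous_last : Continuous fun x : EuclideanSpace ℝ (Fin (d + 1)) => x (Fin.last d) :=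
  (EuclideanSpace.proj (𝕜 := ℝ) (Fin.last d)).continuous

theorem point_add (x' y' : EuclideanSpace ℝ (Fin d)) (s t : ℝ) :
    point (x' + y') (s + t) = point x' s + point y' t := by
  ext i
  refine Fin.lastCases ?_ (fun j => ?_) i <;> simp [point]

theorem point_smul (c : ℝ) (x' : EuclideanSpace ℝ (Fin d)) (t : ℝ) :
    point (c • x') (c * t) = c • point x' t := by
  ext i
  refine Fin.lastCases ?_ (fun j => ?_) i <;> simp [point]

theorem continuous_point_zero :
    Continuous fun x' : EuclideanSpace ℝ (Fin d) => point x' 0 := by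
  let l : EuclideanSpace ℝ (Fin d) →ₗ[ℝ] EuclideanSpace ℝ (Fin (d + 1)) :=
    { toFun := fun x' => point x' 0
      map_add' := fun x y => by simpa using point_add x y 0 0
      map_smul' := fun c x => by simpa using point_smul c x 0 }
  exact l.continuous_of_finiteDimensional

/-- The profile `(1 + |y|²)^(-(d+1)/2)` of the Poisson kernel at height one. -/
noncomputable def cauchyProfile (y : EuclideanSpace ℝ (Fin d)) : ℝ :=
  (1 + ‖y‖ ^ 2) ^ (-((d : ℝ) + 1) / 2)

theorem cauchyProfile_pos (y : EuclideanSpace ℝ (Fin d)) : 0 < cauchyProfile y := by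
  unfold cauchyProfile; positivity

theorem continuous_cauchyProfile : Continuous (cauchyProfile (d := d)) :=
  Continuous.rpow_const (by fun_prop) fun y => Or.inl (by positivity)

theorem integrable_cauchyProfile : Integrable (cauchyProfile (d := d)) :=
  integrable_rpow_neg_one_add_norm_sq (by simp)

theorem integral_cauchyProfile_pos : 0 < ∫ y, cauchyProfile (d := d) y := by
  rw [integral_pos_iff_support_of_nonneg (fun y => (cauchyProfile_pos y).le)
    integrable_cauchyProfile]
  have : Function.support (cauchyProfile (d := d)) = univ := by
    ext y; simp [(cauchyProfile_pos y).ne']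
  rw [this]
  exact isOpen_univ.measure_pos volume univ_nonempty

/-- The Poisson integral of `f`, written as an average of `f (x' + t y)` over `y`; in this form it
also makes sense, and equals `f`, on the boundary `t = 0`. -/
noncomputable def poissonIntegral (f : EuclideanSpace ℝ (Fin d) → ℝ)
    (x : EuclideanSpace ℝ (Fin (d + 1))) : ℝ :=
  (∫ y, cauchyProfile (d := d) y)⁻¹ *
    ∫ y, cauchyProfile y * f (tangential x + x (Fin.last d) • y)

theorem integrable_cauchyProfile_mul {f : EuclideanSpace ℝ (Fin d) → ℝ} (hf : Continuous f) {M : ℝ}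
    (hM : ∀ y, |f y| ≤ M) : Integrable fun y => cauchyProfile y * f y := by
  refine integrable_cauchyProfile.mul_bdd (c := M) hf.aestronglyMeasurable ?_
  exact ae_of_all _ hM

theorem continuous_poissonIntegral {f : EuclideanSpace ℝ (Fin d) → ℝ} (hf : Continuous f) {M : ℝ}
    (hM : ∀ y, |f y| ≤ M) : Continuous (poissonIntegral f) := by
  refine continuous_const.mul ?_
  refine continuous_of_dominated (bound := fun y => cauchyProfile y * M) ?_ ?_ ?_ ?_
  · intro x
    exact (continuous_cauchyProfile.mul (hf.comp (by fun_prop))).aestronglyMeasurable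
  · intro x
    refine ae_of_all _ fun y => ?_
    rw [norm_mul, Real.norm_of_nonneg (cauchyProfile_pos y).le]
    exact mul_le_mul_of_nonneg_left (hM _) (cauchyProfile_pos y).le
  · exact integrable_cauchyProfile.mul_const M
  · refine ae_of_all _ fun y => ?_
    exact continuous_const.mul (hf.comp (continuous_tangential.add
      (continuous_last.smul continuous_const)))

theorem abs_poissonIntegral_le {f : EuclideanSpace ℝ (Fin d) → ℝ} {M : ℝ}
    (hM : ∀ y, |f y| ≤ M) (x : EuclideanSpace ℝ (Fin (d + 1))) : |poissonIntegral f x| ≤ M := by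
  have hZ := integral_cauchyProfile_pos (d := d)
  rw [poissonIntegral, abs_mul, abs_of_pos (inv_pos.2 hZ), inv_mul_le_iff₀ hZ,
    ← integral_mul_const, ← Real.norm_eq_abs]
  refine norm_integral_le_of_norm_le (integrable_cauchyProfile.mul_const M)
    (ae_of_all _ fun y => ?_)
  rw [norm_mul, Real.norm_of_nonneg (cauchyProfile_pos y).le]
  exact mul_le_mul_of_nonneg_left (hM _) (cauchyProfile_pos y).le

theorem poissonIntegral_of_last_eq_zero (f : EuclideanSpace ℝ (Fin d) → ℝ)
    {x : EuclideanSpace ℝ (Fin (d + 1))} (hx : x (Fin.last d) = 0) :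
    poissonIntegral f x = f (tangential x) := by
  have hZ := integral_cauchyProfile_pos (d := d)
  simp only [poissonIntegral, hx, zero_smul, add_zero, integral_mul_const]
  field_simp

/-- The Poisson kernel at height `t`, up to the factor `(∫ cauchyProfile)⁻¹`. -/
noncomputable def cauchyKernel (t : ℝ) (z : EuclideanSpace ℝ (Fin d)) : ℝ :=
  t * (‖z‖ ^ 2 + t ^ 2) ^ (-((d : ℝ) + 1) / 2)

/-- The dilation by `t` carries the kernel at height `t` to the one at height one. -/
theorem cauchyKernel_smul {t : ℝ} (ht : 0 < t) (y : EuclideanSpace ℝ (Fin d)) :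
    t ^ d * cauchyKernel t (t • y) = cauchyProfile y := by
  have h1 : ‖t • y‖ ^ 2 + t ^ 2 = t ^ 2 * (1 + ‖y‖ ^ 2) := by
    rw [norm_smul, Real.norm_of_nonneg ht.le]; ring
  have h2 : (t ^ 2) ^ (-((d : ℝ) + 1) / 2) = (t ^ (d + 1))⁻¹ := by
    rw [← Real.rpow_natCast t 2, ← Real.rpow_mul ht.le, ← Real.rpow_natCast t (d + 1),
      ← Real.rpow_neg ht.le]
    congr 1
    push_cast
    ring
  rw [cauchyKernel, h1, Real.mul_rpow (by positivity) (by positivity), h2, cauchyProfile]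
  field_simp
  ring

theorem integral_cauchyKernel_mul {t : ℝ} (ht : 0 < t) (g : EuclideanSpace ℝ (Fin d) → ℝ) :
    ∫ z, cauchyKernel t z * g z = ∫ y, cauchyProfile y * g (t • y) := by
  have h := Measure.integral_comp_smul (volume : Measure (EuclideanSpace ℝ (Fin d)))
    (fun z => cauchyKernel t z * g z) t
  rw [finrank_euclideanSpace_fin, abs_of_pos (by positivity), smul_eq_mul] at h
  have h2 : ∫ z, cauchyKernel t z * g z =
      t ^ d * ∫ y, cauchyKernel t (t • y) * g (t • y) := by
    rw [h]; field_simp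
  rw [h2, ← integral_const_mul]
  refine integral_congr_ae (ae_of_all _ fun y => ?_)
  simp only [← cauchyKernel_smul ht y]
  ring

theorem integrable_cauchyKernel_mul_iff {t : ℝ} (ht : 0 < t) (g : EuclideanSpace ℝ (Fin d) → ℝ) :
    Integrable (fun z => cauchyKernel t z * g z) ↔
      Integrable fun y => cauchyProfile y * g (t • y) := by
  rw [← integrable_comp_smul_iff volume _ ht.ne']
  have : (fun y => cauchyProfile y * g (t • y)) =
      fun y => t ^ d * (cauchyKernel t (t • y) * g (t • y)) := by
    ext y; rw [← cauchyKernel_smul ht y]; ring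
  rw [this, integrable_const_mul_iff (by simp [ht.ne'])]

theorem poissonIntegral_eq_cauchyKernel (f : EuclideanSpace ℝ (Fin d) → ℝ)
    {x : EuclideanSpace ℝ (Fin (d + 1))} (hx : x ∈ upperHalfSpace d) :
    poissonIntegral f x = (∫ y, cauchyProfile (d := d) y)⁻¹ *
      ∫ z, cauchyKernel (x (Fin.last d)) z * f (tangential x + z) := by
  rw [integral_cauchyKernel_mul hx fun z => f (tangential x + z)]
  rfl

theorem poissonKernel_point (z : EuclideanSpace ℝ (Fin d)) (x : EuclideanSpace ℝ (Fin (d + 1))) :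
    poissonKernel (point z 0) x = cauchyKernel (x (Fin.last d)) (z - tangential x) := by
  rw [poissonKernel, cauchyKernel, norm_sq_eq, tangential_sub, tangential_point, norm_sub_rev]
  simp

theorem poissonIntegral_eq_poissonKernel (f : EuclideanSpace ℝ (Fin d) → ℝ)
    {x : EuclideanSpace ℝ (Fin (d + 1))} (hx : x ∈ upperHalfSpace d) :
    poissonIntegral f x = (∫ y, cauchyProfile (d := d) y)⁻¹ *
      ∫ z, poissonKernel (point z 0) x * f z := by
  rw [poissonIntegral_eq_cauchyKernel f hx]
  congr 1
  rw [← integral_sub_right_eq_self _ (tangential x)]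
  simp [poissonKernel_point]

/-- On a compact set bounded away from the boundary the Poisson kernel decays in the pole like
`cauchyProfile`. -/
theorem exists_poissonKernel_le {K : Set (EuclideanSpace ℝ (Fin (d + 1)))} (hK : IsCompact K)
    (hKH : K ⊆ upperHalfSpace d) :
    ∃ A : ℝ, ∀ x ∈ K, ∀ z, |poissonKernel (point z 0) x| ≤ A * cauchyProfile z := by
  rcases K.eq_empty_or_nonempty with rfl | hne
  · exact ⟨0, by simp⟩
  obtain ⟨x₀, hx₀, hmin⟩ := hK.exists_isMinOn hne continuous_last.continuousOn
  obtain ⟨R, hR⟩ := hK.isBounded.exists_norm_le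
  set δ := x₀ (Fin.last d) with hδ
  have hδ0 : 0 < δ := hKH hx₀
  set c : ℝ := (1 + 2 * R ^ 2) / δ ^ 2 + 2 with hc
  have hc0 : 0 < c := by positivity
  set γ : ℝ := -((d : ℝ) + 1) / 2 with hγ
  have hγ0 : γ ≤ 0 := by
    have : (0 : ℝ) ≤ d := Nat.cast_nonneg d
    rw [hγ]; linarith
  refine ⟨R * (c⁻¹) ^ γ, fun x hx z => ?_⟩
  have hxt : 0 < x (Fin.last d) := hKH hx
  have hδx : δ ≤ x (Fin.last d) := hmin hx
  have hsq : ‖x - point z 0‖ ^ 2 = ‖tangential x - z‖ ^ 2 + x (Fin.last d) ^ 2 := by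
    rw [norm_sq_eq, tangential_sub, tangential_point]; simp
  have hxR : ‖x‖ ^ 2 ≤ R ^ 2 := by
    have := hR x hx
    gcongr
  have hx2 := norm_sq_eq x
  have hxtR : x (Fin.last d) ≤ R := by
    refine le_trans ?_ (hR x hx)
    refine abs_le_of_sq_le_sq' ?_ (norm_nonneg x) |>.2
    nlinarith [sq_nonneg ‖tangential x‖]
  have hlow : δ ^ 2 ≤ ‖x - point z 0‖ ^ 2 := by
    rw [hsq]
    nlinarith [sq_nonneg ‖tangential x - z‖]
  have hz : ‖z‖ ^ 2 ≤ 2 * ‖tangential x - z‖ ^ 2 + 2 * ‖tangential x‖ ^ 2 := by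
    have h1 : ‖z‖ ≤ ‖tangential x - z‖ + ‖tangential x‖ := by
      have := norm_sub_le (tangential x) (tangential x - z)
      rw [sub_sub_cancel] at this
      linarith
    nlinarith [norm_nonneg z, sq_nonneg (‖tangential x - z‖ - ‖tangential x‖)]
  have hcomp : c⁻¹ * (1 + ‖z‖ ^ 2) ≤ ‖x - point z 0‖ ^ 2 := by
    rw [inv_mul_le_iff₀ hc0, hc, add_mul]
    have h1 : 1 + 2 * R ^ 2 ≤ (1 + 2 * R ^ 2) / δ ^ 2 * ‖x - point z 0‖ ^ 2 := by
      rw [div_mul_eq_mul_div, le_div_iff₀ (by positivity)]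
      gcongr
    nlinarith [sq_nonneg (x (Fin.last d))]
  rw [poissonKernel, abs_of_nonneg (by positivity), cauchyProfile, mul_assoc,
    ← Real.mul_rpow (by positivity) (by positivity)]
  exact mul_le_mul hxtR (Real.rpow_le_rpow_of_nonpos (by positivity) hcomp hγ0) (by positivity)
    (by linarith)

/-- A Bochner integral of vectors of a subspace lies in the closure of that subspace. -/
theorem exists_mem_submodule_dist_integral_lt {α X : Type*} [MeasurableSpace α] {μ : Measure α}
    [NormedAddCommGroup X] [NormedSpace ℝ X] [CompleteSpace X] (S : Submodule ℝ X) {g : α → X}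
    (hg : Integrable g μ) (hgS : ∀ a, g a ∈ S) {ε : ℝ} (hε : 0 < ε) :
    ∃ s ∈ S, dist (∫ a, g a ∂μ) s < ε := by
  have : CompleteSpace S.topologicalClosure := S.isClosed_topologicalClosure.completeSpace_coe
  let g' : α → S.topologicalClosure := fun a => ⟨g a, S.le_topologicalClosure (hgS a)⟩
  have hg' : Integrable g' μ := by
    refine ⟨?_, hg.2⟩
    exact Topology.IsEmbedding.subtypeVal.aestronglyMeasurable_comp_iff.1 hg.1
  have hint : ∫ a, g a ∂μ = S.topologicalClosure.subtypeL (∫ a, g' a ∂μ) :=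
    S.topologicalClosure.subtypeL.integral_comp_comm hg'
  have hmem : ∫ a, g a ∂μ ∈ closure (S : Set X) := by
    rw [hint]
    exact Subtype.coe_prop _
  exact Metric.mem_closure_iff.1 hmem ε hε

/-- A Poisson integral is, on compact subsets of the half-space, a uniform limit of harmonic
functions: it is a Bochner integral of harmonic functions in `C(K, ℝ)`. -/
theorem exists_harmonic_approx {f : EuclideanSpace ℝ (Fin d) → ℝ} (hf : Continuous f) {M : ℝ}
    (hM : ∀ y, |f y| ≤ M) {K : Set (EuclideanSpace ℝ (Fin (d + 1)))} (hK : IsCompact K)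
    (hKH : K ⊆ upperHalfSpace d) {ε : ℝ} (hε : 0 < ε) :
    ∃ h : EuclideanSpace ℝ (Fin (d + 1)) → ℝ, HarmonicOnNhd h (upperHalfSpace d) ∧
      ∀ x ∈ K, |poissonIntegral f x - h x| ≤ ε := by
  have : CompactSpace K := isCompact_iff_compactSpace.1 hK
  let S : Submodule ℝ C(K, ℝ) :=
    { carrier := {g | ∃ u : EuclideanSpace ℝ (Fin (d + 1)) → ℝ,
        HarmonicOnNhd u (upperHalfSpace d) ∧ ∀ x : K, g x = u x}
      add_mem' := by
        rintro a b ⟨u, hu, hau⟩ ⟨v, hv, hbv⟩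
        exact ⟨u + v, hu.add hv, fun x => by simp [hau, hbv]⟩
      zero_mem' := ⟨fun _ => 0, harmonicOnNhd_const 0, fun x => rfl⟩
      smul_mem' := by
        rintro c a ⟨u, hu, hau⟩
        exact ⟨c • u, hu.const_smul, fun x => by simp [hau]⟩ }
  have hcont : Continuous fun p : EuclideanSpace ℝ (Fin d) × K =>
      poissonKernel (point p.1 0) (p.2 : EuclideanSpace ℝ (Fin (d + 1))) * f p.1 := by
    refine Continuous.mul (Continuous.mul (continuous_last.comp
      (continuous_subtype_val.comp continuous_snd)) (Continuous.rpow_const ?_ ?_))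
      (hf.comp continuous_fst)
    · have := (continuous_point_zero (d := d)).comp
        (continuous_fst (X := EuclideanSpace ℝ (Fin d)) (Y := K))
      exact ((continuous_subtype_val.comp continuous_snd).sub this).norm.pow 2
    · rintro ⟨z, x, hx⟩
      left
      have hxt : 0 < x (Fin.last d) := hKH hx
      rw [norm_sq_eq]
      simp only [PiLp.sub_apply, point_last]
      positivity
  let Q : C(EuclideanSpace ℝ (Fin d), C(K, ℝ)) := ContinuousMap.curry ⟨_, hcont⟩
  have hQ : ∀ z x, Q z x = poissonKernel (point z 0) (x : EuclideanSpace ℝ (Fin (d + 1))) * f z :=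
    fun z x => rfl
  have hQS : ∀ z, Q z ∈ S := fun z =>
    ⟨f z • poissonKernel (point z 0), (harmonicOnNhd_poissonKernel (by simp)).const_smul,
      fun x => by rw [hQ, Pi.smul_apply, smul_eq_mul, mul_comm]⟩
  obtain ⟨A, hA⟩ := exists_poissonKernel_le hK hKH
  have hM0 : 0 ≤ M := (abs_nonneg _).trans (hM 0)
  have hA0 : ∀ z : EuclideanSpace ℝ (Fin d), 0 ≤ |A| * cauchyProfile z := fun z =>
    mul_nonneg (abs_nonneg A) (cauchyProfile_pos z).le
  have hQi : Integrable Q := by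
    refine ((integrable_cauchyProfile.const_mul |A|).mul_const M).mono'
      Q.continuous.aestronglyMeasurable (ae_of_all _ fun z => ?_)
    rw [ContinuousMap.norm_le _ (mul_nonneg (hA0 z) hM0)]
    intro x
    rw [hQ, norm_mul]
    refine mul_le_mul ((hA x x.2 z).trans ?_) (hM z) (norm_nonneg _) (hA0 z)
    exact mul_le_mul_of_nonneg_right (le_abs_self A) (cauchyProfile_pos z).le
  obtain ⟨g, hgS, hg⟩ := exists_mem_submodule_dist_integral_lt S hQi hQS
    (mul_pos hε (integral_cauchyProfile_pos (d := d)))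
  obtain ⟨u, hu, hgu⟩ := S.smul_mem (∫ y, cauchyProfile (d := d) y)⁻¹ hgS
  refine ⟨u, hu, fun x hx => ?_⟩
  have h1 := (ContinuousMap.dist_apply_le_dist (⟨x, hx⟩ : K)).trans hg.le
  have h2 : (∫ z, Q z) ⟨x, hx⟩ = ∫ z, Q z ⟨x, hx⟩ :=
    ((ContinuousMap.evalCLM ℝ (⟨x, hx⟩ : K)).integral_comp_comm hQi).symm
  rw [Real.dist_eq, h2] at h1
  have h3 := hgu ⟨x, hx⟩
  rw [ContinuousMap.smul_apply, smul_eq_mul] at h3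
  have hZ := integral_cauchyProfile_pos (d := d)
  rw [poissonIntegral_eq_poissonKernel f (hKH hx), ← h3, ← mul_sub, abs_mul,
    abs_of_pos (inv_pos.2 hZ), inv_mul_le_iff₀ hZ, mul_comm]
  exact h1

/-! ### Uniqueness and the Poisson representation -/

theorem last_nonneg {x : EuclideanSpace ℝ (Fin (d + 1))} (hx : x ∈ upperHalfSpace d) :
    0 ≤ x (Fin.last d) :=
  have h : 0 < x (Fin.last d) := hx
  h.le

theorem closure_upperHalfSpace :
    closure (upperHalfSpace d) = {x | 0 ≤ x (Fin.last d)} := by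
  refine Subset.antisymm (closure_minimal (fun x hx => last_nonneg hx)
    (isClosed_le continuous_const continuous_last)) fun x hx => ?_
  have hx' : 0 ≤ x (Fin.last d) := hx
  have hc : ContinuousWithinAt
      (fun s : ℝ => x + s • EuclideanSpace.single (Fin.last d) (1 : ℝ)) (Ioi 0) 0 := by fun_prop
  have := hc.mem_closure (t := upperHalfSpace d) (by simp) (fun s hs => by
    have hs' : (0 : ℝ) < s := hs
    change 0 < (x + s • EuclideanSpace.single (Fin.last d) (1 : ℝ)) (Fin.last d)
    simp
    linarith)
  simpa using this

/-- The comparison step behind uniqueness: on the half ball of radius `R` the harmonic polynomial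
`(|x|² - (d+1) t² + (d+1) R t) / R²` is nonnegative, and at least `1` on the spherical part. -/
theorem le_poissonIntegral_add {U : EuclideanSpace ℝ (Fin (d + 1)) → ℝ}
    (hU : HarmonicOnNhd U (upperHalfSpace d)) (hc : ContinuousOn U (closure (upperHalfSpace d)))
    {f : EuclideanSpace ℝ (Fin d) → ℝ} (hf : Continuous f) (hfU : ∀ y, U (point y 0) = f y) {M : ℝ}
    (hM : ∀ x ∈ closure (upperHalfSpace d), |U x| ≤ M) {R : ℝ} (hR : 0 < R)
    {ε : ℝ} (hε : 0 < ε) {x : EuclideanSpace ℝ (Fin (d + 1))} (hx : x ∈ upperHalfSpace d)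
    (hxR : ‖x‖ ≤ R) :
    U x ≤ poissonIntegral f x + ε + 2 * M * ((‖x‖ ^ 2 - (d + 1) * x (Fin.last d) ^ 2 +
      (d + 1) * R * x (Fin.last d)) / R ^ 2) := by
  rw [closure_upperHalfSpace] at hc hM
  have hfM : ∀ y, |f y| ≤ M := fun y => by
    rw [← hfU]; exact hM _ (by simp)
  have hM0 : 0 ≤ M := (abs_nonneg _).trans (hfM 0)
  have hFc := continuous_poissonIntegral hf hfM
  have hFM := abs_poissonIntegral_le hfM
  set F := poissonIntegral f with hF
  have hd0 : (0 : ℝ) ≤ d := Nat.cast_nonneg d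
  set b : EuclideanSpace ℝ (Fin (d + 1)) → ℝ := fun x =>
    (1 / R ^ 2) * ‖x‖ ^ 2 + (-(d + 1) / R ^ 2) * x (Fin.last d) ^ 2
      + ((d + 1) / R) * x (Fin.last d) with hb
  have hbeq : ∀ x, b x = (‖x‖ ^ 2 - (d + 1) * x (Fin.last d) ^ 2 +
      (d + 1) * R * x (Fin.last d)) / R ^ 2 := fun x => by
    simp only [hb]; field_simp; ring
  have hbcd : ContDiff ℝ 2 b := by
    have hl : ContDiff ℝ 2 fun x : EuclideanSpace ℝ (Fin (d + 1)) => x (Fin.last d) :=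
      (EuclideanSpace.proj (𝕜 := ℝ) (Fin.last d)).contDiff
    exact (((contDiff_norm_sq ℝ).const_smul (1 / R ^ 2)).add
      ((hl.pow 2).const_smul (-((d : ℝ) + 1) / R ^ 2))).add (hl.const_smul (((d : ℝ) + 1) / R))
  have hbh : HarmonicOnNhd b (upperHalfSpace d) := fun z _ =>
    ⟨hbcd.contDiffAt, Eventually.of_forall fun z => by
      rw [hb, laplacian_quadratic, Pi.zero_apply]; field_simp; ring⟩
  have htR : ∀ z : EuclideanSpace ℝ (Fin (d + 1)), ‖z‖ ≤ R → z (Fin.last d) ≤ R := fun z hz =>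
    ((le_abs_self _).trans (PiLp.norm_apply_le z _)).trans hz
  have hb_ge : ∀ z : EuclideanSpace ℝ (Fin (d + 1)), 0 ≤ z (Fin.last d) → ‖z‖ ≤ R →
      ‖z‖ ^ 2 / R ^ 2 ≤ b z := by
    intro z hz hzR
    rw [hbeq]
    gcongr
    have := mul_nonneg (mul_nonneg (by positivity : (0 : ℝ) ≤ d + 1) hz)
      (sub_nonneg.2 (htR z hzR))
    nlinarith
  rw [← hbeq]
  -- The points where `U - F ≥ ε` stay away from the boundary, where `U = F`.
  set K₀ : Set (EuclideanSpace ℝ (Fin (d + 1))) :=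
    {z | 0 ≤ z (Fin.last d)} ∩ Metric.closedBall 0 R with hK₀
  have hK₀c : IsCompact K₀ := (isCompact_closedBall _ _).inter_left
    (isClosed_le continuous_const continuous_last)
  have hwc : ContinuousOn (fun z => U z - F z) K₀ :=
    (hc.mono inter_subset_left).sub hFc.continuousOn
  set K := K₀ ∩ (fun z => U z - F z) ⁻¹' Ici ε with hK
  have hKc : IsCompact K :=
    hK₀c.of_isClosed_subset (hwc.preimage_isClosed_of_isClosed hK₀c.isClosed isClosed_Ici)
      inter_subset_left
  have hKH : K ⊆ upperHalfSpace d := by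
    rintro z ⟨⟨hz0, -⟩, hzε⟩
    have hz0' : 0 ≤ z (Fin.last d) := hz0
    refine lt_of_le_of_ne hz0' fun h => ?_
    have h1 : U z = f (tangential z) := by
      rw [← hfU]
      conv_lhs => rw [← point_tangential z, ← h]
    have h2 : ε ≤ U z - F z := hzε
    rw [hF, poissonIntegral_of_last_eq_zero f h.symm, h1] at h2
    linarith
  -- A frontier point of `K` lies on the sphere, or satisfies `U - F = ε`.
  have hfr : ∀ z ∈ frontier K, U z - F z ≤ ε + 2 * M * b z := by
    intro z hz
    have hzK : z ∈ K := hKc.isClosed.frontier_subset hz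
    have hzH := hKH hzK
    have hzR : ‖z‖ ≤ R := by simpa using hzK.1.2
    have hbz := hb_ge z (last_nonneg hzH) hzR
    rcases hzR.eq_or_lt with hzR' | hzR'
    · rw [hzR', div_self (by positivity)] at hbz
      have h1 := abs_le.1 (hM z (last_nonneg hzH))
      have h2 := abs_le.1 (hFM z)
      nlinarith
    · have hbz0 : 0 ≤ 2 * M * b z := mul_nonneg (by positivity) (le_trans (by positivity) hbz)
      have hle : U z - F z ≤ ε := by
        by_contra! hlt
        refine hz.2 (mem_interior_iff_mem_nhds.2 ?_)
        have hUz : ContinuousAt (fun z => U z - F z) z :=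
          (hU z hzH).1.continuousAt.sub hFc.continuousAt
        filter_upwards [isOpen_upperHalfSpace.mem_nhds hzH, hUz.eventually (lt_mem_nhds hlt),
          continuous_norm.continuousAt.eventually (gt_mem_nhds hzR')] with y h1 h2 h3
        exact ⟨⟨last_nonneg h1, by simpa using h3.le⟩, h2.le⟩
      linarith
  have hKle : ∀ z ∈ K, U z - F z ≤ ε + 2 * M * b z := by
    intro z hz
    refine le_of_forall_pos_le_add fun η hη => ?_
    obtain ⟨h, hh, hFh⟩ := exists_harmonic_approx hf hfM hKc hKH (half_pos hη)
    have hv : HarmonicOnNhd (U - h - (2 * M) • b) (upperHalfSpace d) :=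
      (hU.sub hh).sub hbh.const_smul
    have := le_of_le_frontier hKc (hv.continuousOn.mono hKH) (m := ε + η / 2)
      (fun y hy => ⟨(hv y (hKH (interior_subset hy))).1,
        ((hv y (hKH (interior_subset hy))).2.self_of_nhds).ge⟩)
      (fun y hy => by
        have h1 := hfr y hy
        have h2 := abs_le.1 (hFh y (hKc.isClosed.frontier_subset hy))
        simp only [Pi.sub_apply, Pi.smul_apply, smul_eq_mul]
        linarith) z hz
    have h2 := abs_le.1 (hFh z hz)
    simp only [Pi.sub_apply, Pi.smul_apply, smul_eq_mul] at this
    linarith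
  by_cases hxK : x ∈ K
  · linarith [hKle x hxK]
  · have h1 : U x - F x < ε := by
      by_contra! h
      exact hxK ⟨⟨last_nonneg hx, by simpa using hxR⟩, h⟩
    have h2 : 0 ≤ b x := le_trans (by positivity) (hb_ge x (last_nonneg hx) hxR)
    have : 0 ≤ 2 * M * b x := by positivity
    linarith

/-- One half of the uniqueness statement, obtained by letting `R → ∞` and `ε → 0` in
`le_poissonIntegral_add`. -/
theorem le_poissonIntegral {U : EuclideanSpace ℝ (Fin (d + 1)) → ℝ}
    (hU : HarmonicOnNhd U (upperHalfSpace d)) (hc : ContinuousOn U (closure (upperHalfSpace d)))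
    {f : EuclideanSpace ℝ (Fin d) → ℝ} (hf : Continuous f) (hfU : ∀ y, U (point y 0) = f y) {M : ℝ}
    (hM : ∀ x ∈ closure (upperHalfSpace d), |U x| ≤ M)
    {x : EuclideanSpace ℝ (Fin (d + 1))} (hx : x ∈ upperHalfSpace d) :
    U x ≤ poissonIntegral f x := by
  refine le_of_forall_pos_le_add fun ε hε => ?_
  set a : ℝ := ‖x‖ ^ 2 - (d + 1) * x (Fin.last d) ^ 2 with ha
  set c : ℝ := (d + 1) * x (Fin.last d) with hc'
  have hinv : Tendsto (fun R : ℝ => R⁻¹) atTop (𝓝 0) := tendsto_inv_atTop_zero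
  have hlim : Tendsto (fun R : ℝ => poissonIntegral f x + ε +
      2 * M * (a * (R⁻¹) ^ 2 + c * R⁻¹)) atTop
      (𝓝 (poissonIntegral f x + ε + 2 * M * (a * 0 ^ 2 + c * 0))) :=
    (((hinv.pow 2).const_mul a).add (hinv.const_mul c)).const_mul (2 * M) |>.const_add _
  have := ge_of_tendsto hlim (b := U x) ?_
  · simpa using this
  · filter_upwards [eventually_gt_atTop 0, eventually_ge_atTop ‖x‖] with R hR0 hR
    refine (le_poissonIntegral_add hU hc hf hfU hM hR0 hε hx hR).trans_eq ?_
    congr 2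
    rw [ha, hc']
    field_simp

/-- Poisson representation of bounded harmonic functions continuous up to the boundary. -/
theorem eq_poissonIntegral {U : EuclideanSpace ℝ (Fin (d + 1)) → ℝ}
    (hU : HarmonicOnNhd U (upperHalfSpace d)) (hc : ContinuousOn U (closure (upperHalfSpace d)))
    {M : ℝ} (hM : ∀ x ∈ closure (upperHalfSpace d), |U x| ≤ M)
    {x : EuclideanSpace ℝ (Fin (d + 1))} (hx : x ∈ upperHalfSpace d) :
    U x = poissonIntegral (fun y => U (point y 0)) x := by
  have hf : Continuous fun y : EuclideanSpace ℝ (Fin d) => U (point y 0) :=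
    hc.comp_continuous continuous_point_zero fun y => by rw [closure_upperHalfSpace]; simp
  refine le_antisymm (le_poissonIntegral hU hc hf (fun _ => rfl) hM hx) ?_
  have h := le_poissonIntegral (f := fun y => -U (point y 0)) hU.neg hc.neg hf.neg (fun _ => rfl)
    (fun x hx => by simpa using hM x hx) hx
  have h2 : poissonIntegral (fun y => -U (point y 0)) x =
      -poissonIntegral (fun y => U (point y 0)) x := by
    simp [poissonIntegral, integral_neg]
  rw [h2] at h
  simpa using h

/-! ### Increments of Poisson integrals of Hölder data -/

theorem integrable_cauchyProfile_mul_rpow {α : ℝ} (hα : α ∈ Ioo (0 : ℝ) 1) :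
    Integrable fun y : EuclideanSpace ℝ (Fin d) => cauchyProfile y * ‖y‖ ^ α := by
  have hr : (Module.finrank ℝ (EuclideanSpace ℝ (Fin d)) : ℝ) < d + 1 - α := by
    rw [finrank_euclideanSpace_fin]; linarith [hα.2]
  refine (integrable_rpow_neg_one_add_norm_sq hr).mono' ?_ (ae_of_all _ fun y => ?_)
  · exact (continuous_cauchyProfile.mul
      (continuous_norm.rpow_const fun _ => Or.inr hα.1.le)).aestronglyMeasurable
  · have h0 := cauchyProfile_pos y
    rw [Real.norm_of_nonneg (by positivity)]
    have h1 : ‖y‖ ^ α ≤ (1 + ‖y‖ ^ 2) ^ (α / 2) := by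
      have : ‖y‖ ^ α = (‖y‖ ^ 2) ^ (α / 2) := by
        rw [← Real.rpow_natCast, ← Real.rpow_mul (norm_nonneg y)]
        congr 1; push_cast; ring
      rw [this]
      exact Real.rpow_le_rpow (by positivity) (by linarith) (by linarith [hα.1])
    calc cauchyProfile y * ‖y‖ ^ α ≤ cauchyProfile y * (1 + ‖y‖ ^ 2) ^ (α / 2) := by gcongr
      _ = (1 + ‖y‖ ^ 2) ^ (-((d : ℝ) + 1 - α) / 2) := by
        rw [cauchyProfile, ← Real.rpow_add (by positivity)]
        congr 1; ring

/-- The normalized moment of order `α` of the Poisson kernel at height one. -/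
noncomputable def cauchyMoment (d : ℕ) (α : ℝ) : ℝ :=
  (∫ y, cauchyProfile (d := d) y)⁻¹ * ∫ y : EuclideanSpace ℝ (Fin d), cauchyProfile y * ‖y‖ ^ α

theorem cauchyMoment_nonneg (d : ℕ) (α : ℝ) : 0 ≤ cauchyMoment d α :=
  mul_nonneg (inv_nonneg.2 integral_cauchyProfile_pos.le)
    (integral_nonneg fun y => mul_nonneg (cauchyProfile_pos y).le (by positivity))

section Holder

variable {f : EuclideanSpace ℝ (Fin d) → ℝ} (hf : Continuous f) {M : ℝ} (hM : ∀ y, |f y| ≤ M)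
  {α : ℝ} (hα : α ∈ Ioo (0 : ℝ) 1) {C : ℝ} (hC : 0 ≤ C)
  (hfα : ∀ x y, |f x - f y| ≤ C * ‖x - y‖ ^ α)
include hf hM hα hC hfα

theorem abs_poissonIntegral_sub_le (x y : EuclideanSpace ℝ (Fin (d + 1))) :
    |poissonIntegral f x - poissonIntegral f y| ≤ C * ‖tangential x - tangential y‖ ^ α +
      C * cauchyMoment d α * |x (Fin.last d) - y (Fin.last d)| ^ α := by
  have hZ := integral_cauchyProfile_pos (d := d)
  set s := x (Fin.last d) with hs
  set t := y (Fin.last d) with ht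
  have hi : ∀ (p : EuclideanSpace ℝ (Fin d)) (s : ℝ),
      Integrable fun z => cauchyProfile z * f (p + s • z) := fun p s =>
    integrable_cauchyProfile_mul (hf.comp (by fun_prop)) fun z => hM _
  have hpt : ∀ z : EuclideanSpace ℝ (Fin d),
      ‖cauchyProfile z * f (tangential x + s • z) - cauchyProfile z * f (tangential y + t • z)‖ ≤
      cauchyProfile z * (C * ‖tangential x - tangential y‖ ^ α) +
        C * |s - t| ^ α * (cauchyProfile z * ‖z‖ ^ α) := by
    intro z
    have h0 := cauchyProfile_pos z
    rw [← mul_sub, norm_mul, Real.norm_of_nonneg h0.le, Real.norm_eq_abs]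
    have h1 : ‖tangential x + s • z - (tangential y + t • z)‖ ≤
        ‖tangential x - tangential y‖ + |s - t| * ‖z‖ := by
      rw [show tangential x + s • z - (tangential y + t • z) =
        (tangential x - tangential y) + (s - t) • z by rw [sub_smul]; abel]
      refine (norm_add_le _ _).trans ?_
      rw [norm_smul, Real.norm_eq_abs]
    have h2 : ‖tangential x + s • z - (tangential y + t • z)‖ ^ α ≤
        ‖tangential x - tangential y‖ ^ α + |s - t| ^ α * ‖z‖ ^ α := by
      rw [← Real.mul_rpow (abs_nonneg _) (norm_nonneg _)]
      exact (Real.rpow_le_rpow (norm_nonneg _) h1 hα.1.le).trans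
        (Real.rpow_add_le_add_rpow (norm_nonneg _) (by positivity) hα.1.le hα.2.le)
    calc _ ≤ cauchyProfile z * (C * (‖tangential x - tangential y‖ ^ α +
          |s - t| ^ α * ‖z‖ ^ α)) := by
          gcongr
          exact (hfα _ _).trans (by gcongr)
      _ = _ := by ring
  have hint := (integrable_cauchyProfile (d := d)).mul_const
    (C * ‖tangential x - tangential y‖ ^ α)
  have hint2 := (integrable_cauchyProfile_mul_rpow (d := d) hα).const_mul (C * |s - t| ^ α)
  have key := norm_integral_le_of_norm_le (hint.add hint2) (ae_of_all _ hpt)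
  rw [integral_sub (hi _ _) (hi _ _), Real.norm_eq_abs] at key
  simp only [Pi.add_apply] at key
  rw [integral_add hint hint2, integral_mul_const, integral_const_mul] at key
  rw [poissonIntegral, poissonIntegral, ← mul_sub, abs_mul, abs_of_pos (inv_pos.2 hZ),
    inv_mul_le_iff₀ hZ]
  refine key.trans_eq ?_
  rw [cauchyMoment]
  field_simp

end Holder

theorem cauchyKernel_pos {t : ℝ} (ht : 0 < t) (z : EuclideanSpace ℝ (Fin d)) :
    0 < cauchyKernel t z := by
  unfold cauchyKernel; positivity

theorem integral_cauchyKernel {t : ℝ} (ht : 0 < t) :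
    ∫ z, cauchyKernel (d := d) t z = ∫ y, cauchyProfile (d := d) y := by
  simpa using integral_cauchyKernel_mul (d := d) ht fun _ => 1

theorem integrable_cauchyKernel {t : ℝ} (ht : 0 < t) : Integrable (cauchyKernel (d := d) t) := by
  have := (integrable_cauchyKernel_mul_iff (d := d) ht fun _ => 1).2
    (by simpa using integrable_cauchyProfile)
  simpa using this

theorem integrable_cauchyKernel_mul_rpow {t α : ℝ} (ht : 0 < t) (hα : α ∈ Ioo (0 : ℝ) 1) :
    Integrable fun z : EuclideanSpace ℝ (Fin d) => cauchyKernel t z * ‖z‖ ^ α := by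
  rw [integrable_cauchyKernel_mul_iff ht]
  refine ((integrable_cauchyProfile_mul_rpow hα).const_mul (t ^ α)).congr (ae_of_all _ fun y => ?_)
  simp only [norm_smul, Real.norm_of_nonneg ht.le, Real.mul_rpow ht.le (norm_nonneg y)]
  ring

theorem integral_cauchyKernel_mul_rpow {t α : ℝ} (ht : 0 < t) :
    (∫ y, cauchyProfile (d := d) y)⁻¹ *
      ∫ z : EuclideanSpace ℝ (Fin d), cauchyKernel t z * ‖z‖ ^ α = t ^ α * cauchyMoment d α := by
  have h : ∫ z : EuclideanSpace ℝ (Fin d), cauchyKernel t z * ‖z‖ ^ α =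
      t ^ α * ∫ y : EuclideanSpace ℝ (Fin d), cauchyProfile y * ‖y‖ ^ α := by
    rw [integral_cauchyKernel_mul ht fun z : EuclideanSpace ℝ (Fin d) => ‖z‖ ^ α,
      ← integral_const_mul]
    refine integral_congr_ae (ae_of_all _ fun y => ?_)
    simp only [norm_smul, Real.norm_of_nonneg ht.le, Real.mul_rpow ht.le (norm_nonneg y)]
    ring
  rw [h, cauchyMoment, mul_left_comm]

/-- Monotonicity of `P_t / t` in the height `t` turns the difference of two Poisson kernels into a
signed combination of them, whose moments are explicit. -/
theorem abs_cauchyKernel_sub_le {s t : ℝ} (hs : 0 < s) (hst : s < t)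
    (z : EuclideanSpace ℝ (Fin d)) :
    |cauchyKernel t z - cauchyKernel s z| ≤
      (2 * t / s - 1) * cauchyKernel s z - cauchyKernel t z := by
  have h0 := cauchyKernel_pos hs z
  have h1 : cauchyKernel t z ≤ t / s * cauchyKernel s z := by
    have hγ : -((d : ℝ) + 1) / 2 ≤ 0 := by
      have : (0 : ℝ) ≤ d := Nat.cast_nonneg d
      linarith
    rw [cauchyKernel, cauchyKernel, ← mul_assoc, div_mul_cancel₀ _ hs.ne']
    refine mul_le_mul_of_nonneg_left ?_ (hs.trans hst).le
    exact Real.rpow_le_rpow_of_nonpos (by positivity) (by gcongr) hγ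
  have h2 : 1 * cauchyKernel s z ≤ t / s * cauchyKernel s z := by
    gcongr
    rw [one_le_div hs]; exact hst.le
  have h3 : (2 * t / s - 1) * cauchyKernel s z =
    2 * (t / s * cauchyKernel s z) - cauchyKernel s z := by ring
  rw [h3, abs_le]
  constructor <;> linarith

/-- Bernoulli's inequality, applied to `u` or to `u⁻¹` according to the sign of `u - 1`. -/
theorem abs_inv_pow_sub_one_le (n : ℕ) {η u : ℝ} (hη0 : 0 ≤ η) (hη : η < 1) (h1 : 1 - η ≤ u)
    (h2 : u ≤ 1 + η) : |(u ^ n)⁻¹ - 1| ≤ n * η * ((1 - η) ^ n)⁻¹ := by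
  have hu : 0 < u := by linarith
  have h1η : 0 < 1 - η := by linarith
  have hle : (u ^ n)⁻¹ ≤ ((1 - η) ^ n)⁻¹ := by gcongr
  have hge : 1 ≤ ((1 - η) ^ n)⁻¹ := by
    rw [one_le_inv₀ (by positivity)]
    exact pow_le_one₀ h1η.le (by linarith)
  have hb1 := one_add_mul_le_pow (a := u - 1) (by linarith) n
  rw [add_sub_cancel] at hb1
  have huinv : 1 - η ≤ u⁻¹ := by
    rw [le_inv_comm₀ h1η hu, ← one_div, le_div_iff₀ h1η]
    nlinarith
  have hb2 := one_add_mul_le_pow (a := u⁻¹ - 1) (by linarith) n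
  rw [add_sub_cancel, inv_pow] at hb2
  have hn : (0 : ℝ) ≤ n := Nat.cast_nonneg n
  rw [abs_le]
  constructor
  · have : n * η * 1 ≤ n * η * ((1 - η) ^ n)⁻¹ := by gcongr
    nlinarith
  · have h3 : (u ^ n)⁻¹ - 1 = (1 - u ^ n) * (u ^ n)⁻¹ := by field_simp
    rw [h3]
    have h4 : 1 - u ^ n ≤ n * η := by nlinarith
    calc (1 - u ^ n) * (u ^ n)⁻¹ ≤ n * η * (u ^ n)⁻¹ := by gcongr
      _ ≤ _ := by gcongr

theorem cauchyKernel_eq_norm {t : ℝ} (z : EuclideanSpace ℝ (Fin d)) :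
    cauchyKernel t z = t * (‖point z t‖ ^ (d + 1))⁻¹ := by
  have : ‖z‖ ^ 2 + t ^ 2 = ‖point z t‖ ^ 2 := by rw [norm_sq_eq (point z t)]; simp
  rw [cauchyKernel, this, ← Real.rpow_natCast _ 2, ← Real.rpow_natCast _ (d + 1),
    ← Real.rpow_mul (norm_nonneg _), ← Real.rpow_neg (norm_nonneg _)]
  congr 2
  push_cast
  ring

theorem le_norm_point {t : ℝ} (z : EuclideanSpace ℝ (Fin d)) : t ≤ ‖point z t‖ := by
  have := PiLp.norm_apply_le (point z t) (Fin.last d)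
  rw [point_last] at this
  exact (le_abs_self t).trans this

theorem norm_le_norm_point {t : ℝ} (z : EuclideanSpace ℝ (Fin d)) : ‖z‖ ≤ ‖point z t‖ := by
  refine abs_le_of_sq_le_sq' ?_ (norm_nonneg _) |>.2
  rw [norm_sq_eq (point z t), tangential_point]
  nlinarith [sq_nonneg (point z t (Fin.last d))]

theorem norm_point_zero (h : EuclideanSpace ℝ (Fin d)) : ‖point h 0‖ = ‖h‖ := by
  refine (pow_left_inj₀ (norm_nonneg _) (norm_nonneg _) two_ne_zero).1 ?_
  rw [norm_sq_eq (point h 0)]; simp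

/-- Moving the pole by `h` moves `|(z, t)|` by at most `‖h‖`; this is the resulting relative change of
the kernel. -/
theorem abs_cauchyKernel_sub_translate_le {t : ℝ} {z h : EuclideanSpace ℝ (Fin d)}
    (hh : ‖h‖ < t) :
    |cauchyKernel t (z - h) - cauchyKernel t z| ≤
      (d + 1) * ‖h‖ * ((1 - ‖h‖ / t) ^ (d + 1))⁻¹ * (cauchyKernel t z / ‖point z t‖) := by
  have ht : 0 < t := (norm_nonneg h).trans_lt hh
  have htρ := le_norm_point (t := t) z
  have hρ : 0 < ‖point z t‖ := ht.trans_le htρ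
  have hρ₁ : 0 < ‖point (z - h) t‖ := ht.trans_le (le_norm_point (t := t) (z - h))
  have hdiff : point z t = point (z - h) t + point h 0 := by
    rw [← point_add, sub_add_cancel, add_zero]
  have hd1 : |‖point (z - h) t‖ - ‖point z t‖| ≤ ‖h‖ := by
    refine (abs_norm_sub_norm_le _ _).trans_eq ?_
    rw [hdiff, ← norm_point_zero h, ← norm_neg (point h 0)]
    congr 1; abel
  set ρ := ‖point z t‖ with hρdef
  set ρ₁ := ‖point (z - h) t‖ with hρ₁def
  obtain ⟨hd2, hd3⟩ := abs_le.1 hd1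
  have hη : ‖h‖ / ρ ≤ ‖h‖ / t := by gcongr
  have hηt : ‖h‖ / t < 1 := (div_lt_one ht).2 hh
  have key := abs_inv_pow_sub_one_le (d + 1) (η := ‖h‖ / ρ) (u := ρ₁ / ρ) (by positivity)
    (hη.trans_lt hηt) (by rw [le_div_iff₀ hρ, sub_mul, div_mul_cancel₀ _ hρ.ne']; linarith)
    (by rw [div_le_iff₀ hρ, add_mul, div_mul_cancel₀ _ hρ.ne']; linarith)
  have heq : cauchyKernel t (z - h) - cauchyKernel t z =
      cauchyKernel t z * (((ρ₁ / ρ) ^ (d + 1))⁻¹ - 1) := by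
    rw [cauchyKernel_eq_norm, cauchyKernel_eq_norm, ← hρdef, ← hρ₁def, div_pow, inv_div]
    field_simp
  have hP := cauchyKernel_pos ht z
  rw [heq, abs_mul, abs_of_pos hP]
  have h1t : 0 < 1 - ‖h‖ / t := by linarith
  calc _ ≤ cauchyKernel t z * ((d + 1 : ℕ) * (‖h‖ / ρ) * ((1 - ‖h‖ / ρ) ^ (d + 1))⁻¹) := by gcongr
    _ ≤ cauchyKernel t z * ((d + 1 : ℕ) * (‖h‖ / ρ) * ((1 - ‖h‖ / t) ^ (d + 1))⁻¹) := by gcongr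
    _ = _ := by push_cast; ring

section Holder

variable {f : EuclideanSpace ℝ (Fin d) → ℝ} (hf : Continuous f) {M : ℝ} (hM : ∀ y, |f y| ≤ M)
include hf hM

theorem integrable_cauchyKernel_mul (p : EuclideanSpace ℝ (Fin d)) {t : ℝ} (ht : 0 < t) :
    Integrable fun z => cauchyKernel t z * f (p + z) :=
  (integrable_cauchyKernel_mul_iff ht fun z => f (p + z)).2
    (integrable_cauchyProfile_mul (hf.comp (by fun_prop)) fun _ => hM _)

variable {α : ℝ} (hα : α ∈ Ioo (0 : ℝ) 1) {C : ℝ} (hfα : ∀ x y, |f x - f y| ≤ C * ‖x - y‖ ^ α)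
include hα hfα

/-- The right-hand side vanishes at `s = t`, and its derivative there yields the bound for the normal
derivative. -/
theorem abs_poissonIntegral_normal_sub_le (x' : EuclideanSpace ℝ (Fin d)) {s t : ℝ} (hs : 0 < s)
    (hst : s < t) :
    |poissonIntegral f (point x' t) - poissonIntegral f (point x' s)| ≤
      C * cauchyMoment d α * ((2 * t / s - 1) * s ^ α - t ^ α) := by
  have hZ := integral_cauchyProfile_pos (d := d)
  have ht := hs.trans hst
  -- Both kernels have the same integral, so the constant `f x'` may be subtracted from the data.
  have hpt : ∀ z : EuclideanSpace ℝ (Fin d),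
      ‖(cauchyKernel t z * f (x' + z) - cauchyKernel s z * f (x' + z)) -
        (cauchyKernel t z * f x' - cauchyKernel s z * f x')‖ ≤
      C * ((2 * t / s - 1) * (cauchyKernel s z * ‖z‖ ^ α) - cauchyKernel t z * ‖z‖ ^ α) := by
    intro z
    have h1 := abs_cauchyKernel_sub_le hs hst z
    have h2 := hfα (x' + z) x'
    rw [add_sub_cancel_left] at h2
    rw [show (cauchyKernel t z * f (x' + z) - cauchyKernel s z * f (x' + z)) -
        (cauchyKernel t z * f x' - cauchyKernel s z * f x') =
        (cauchyKernel t z - cauchyKernel s z) * (f (x' + z) - f x') by ring, norm_mul]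
    refine (mul_le_mul h1 h2 (abs_nonneg _) ((abs_nonneg _).trans h1)).trans_eq ?_
    ring
  have hit := integrable_cauchyKernel_mul hf hM x' ht
  have his := integrable_cauchyKernel_mul hf hM x' hs
  have hit1 := (integrable_cauchyKernel (d := d) ht).mul_const (f x')
  have his1 := (integrable_cauchyKernel (d := d) hs).mul_const (f x')
  have hmt := integrable_cauchyKernel_mul_rpow (d := d) ht hα
  have hms := (integrable_cauchyKernel_mul_rpow (d := d) hs hα).const_mul (2 * t / s - 1)
  have hd : Integrable fun z => cauchyKernel t z * f (x' + z) - cauchyKernel s z * f (x' + z) :=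
    hit.sub his
  have hd1 : Integrable fun z => cauchyKernel t z * f x' - cauchyKernel s z * f x' :=
    hit1.sub his1
  have key := norm_integral_le_of_norm_le ((hms.sub hmt).const_mul C) (ae_of_all _ hpt)
  rw [integral_sub hd hd1, integral_sub hit his, integral_sub hit1 his1,
    integral_const_mul] at key
  simp only [Pi.sub_apply] at key
  rw [integral_sub hms hmt, integral_const_mul, integral_mul_const, integral_mul_const,
    integral_cauchyKernel ht, integral_cauchyKernel hs, sub_self, sub_zero, Real.norm_eq_abs] at key
  rw [poissonIntegral_eq_cauchyKernel f (x := point x' t) (by simpa [upperHalfSpace] using ht),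
    poissonIntegral_eq_cauchyKernel f (x := point x' s) (by simpa [upperHalfSpace] using hs),
    ← mul_sub, abs_mul, abs_of_pos (inv_pos.2 hZ)]
  simp only [tangential_point, point_last]
  refine (mul_le_mul_of_nonneg_left key (inv_pos.2 hZ).le).trans_eq ?_
  have e1 := integral_cauchyKernel_mul_rpow (d := d) (α := α) hs
  have e2 := integral_cauchyKernel_mul_rpow (d := d) (α := α) ht
  linear_combination C * (2 * t / s - 1) * e1 - C * e2

theorem abs_poissonIntegral_tangential_sub_le (hC : 0 ≤ C) (x' h : EuclideanSpace ℝ (Fin d)) {t : ℝ}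
    (hh : ‖h‖ < t) :
    |poissonIntegral f (point (x' + h) t) - poissonIntegral f (point x' t)| ≤
      (d + 1) * ‖h‖ * ((1 - ‖h‖ / t) ^ (d + 1))⁻¹ * (C * t ^ (α - 1)) := by
  have hZ := integral_cauchyProfile_pos (d := d)
  have ht : 0 < t := (norm_nonneg h).trans_lt hh
  have h1t : 0 < 1 - ‖h‖ / t := sub_pos.2 ((div_lt_one ht).2 hh)
  have hpt : ∀ z : EuclideanSpace ℝ (Fin d),
      ‖(cauchyKernel t (z - h) * f (x' + z) - cauchyKernel t z * f (x' + z)) -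
        (cauchyKernel t (z - h) * f x' - cauchyKernel t z * f x')‖ ≤
      (d + 1) * ‖h‖ * ((1 - ‖h‖ / t) ^ (d + 1))⁻¹ * (C * t ^ (α - 1)) * cauchyKernel t z := by
    intro z
    have h1 := abs_cauchyKernel_sub_translate_le (z := z) hh
    have hP := cauchyKernel_pos ht z
    have hρ : 0 < ‖point z t‖ := ht.trans_le (le_norm_point z)
    have h2 := hfα (x' + z) x'
    rw [add_sub_cancel_left] at h2
    have h3 : ‖z‖ ^ α ≤ t ^ (α - 1) * ‖point z t‖ := by
      have e : ‖point z t‖ ^ α = ‖point z t‖ ^ (α - 1) * ‖point z t‖ := by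
        rw [← Real.rpow_add_one hρ.ne', sub_add_cancel]
      calc ‖z‖ ^ α ≤ ‖point z t‖ ^ α :=
            Real.rpow_le_rpow (norm_nonneg _) (norm_le_norm_point z) hα.1.le
        _ = ‖point z t‖ ^ (α - 1) * ‖point z t‖ := e
        _ ≤ _ := by
          refine mul_le_mul_of_nonneg_right ?_ hρ.le
          exact Real.rpow_le_rpow_of_nonpos ht (le_norm_point z) (by linarith [hα.2])
    rw [show (cauchyKernel t (z - h) * f (x' + z) - cauchyKernel t z * f (x' + z)) -
        (cauchyKernel t (z - h) * f x' - cauchyKernel t z * f x') =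
        (cauchyKernel t (z - h) - cauchyKernel t z) * (f (x' + z) - f x') by ring, norm_mul]
    calc _ ≤ (d + 1) * ‖h‖ * ((1 - ‖h‖ / t) ^ (d + 1))⁻¹ * (cauchyKernel t z / ‖point z t‖) *
          (C * (t ^ (α - 1) * ‖point z t‖)) := by
          refine mul_le_mul h1 (h2.trans ?_) (abs_nonneg _) (by positivity)
          gcongr
      _ = _ := by field_simp
  have hi := integrable_cauchyKernel_mul hf hM x' ht
  have hih : Integrable fun z => cauchyKernel t (z - h) * f (x' + z) := by
    have := (integrable_cauchyKernel_mul hf hM (x' + h) ht).comp_sub_right h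
    simpa [add_assoc] using this
  have hi1 := (integrable_cauchyKernel (d := d) ht).mul_const (f x')
  have hih1 := hi1.comp_sub_right h
  have hd : Integrable fun z =>
      cauchyKernel t (z - h) * f (x' + z) - cauchyKernel t z * f (x' + z) := hih.sub hi
  have hd1 : Integrable fun z => cauchyKernel t (z - h) * f x' - cauchyKernel t z * f x' :=
    hih1.sub hi1
  have key := norm_integral_le_of_norm_le ((integrable_cauchyKernel (d := d) ht).const_mul
    ((d + 1) * ‖h‖ * ((1 - ‖h‖ / t) ^ (d + 1))⁻¹ * (C * t ^ (α - 1)))) (ae_of_all _ hpt)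
  rw [integral_sub hd hd1, integral_sub hih hi, integral_sub hih1 hi1,
    integral_const_mul, integral_sub_right_eq_self (fun z => cauchyKernel t z * f x') h,
    sub_self, sub_zero, integral_cauchyKernel ht, Real.norm_eq_abs] at key
  rw [poissonIntegral_eq_cauchyKernel f (x := point (x' + h) t)
      (by simpa [upperHalfSpace] using ht),
    poissonIntegral_eq_cauchyKernel f (x := point x' t) (by simpa [upperHalfSpace] using ht),
    ← mul_sub, abs_mul, abs_of_pos (inv_pos.2 hZ), inv_mul_le_iff₀ hZ]
  simp only [tangential_point, point_last]
  have e : ∫ z, cauchyKernel t z * f (x' + h + z) = ∫ z, cauchyKernel t (z - h) * f (x' + z) := by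
    rw [← integral_sub_right_eq_self _ h]
    simp [add_assoc]
  rw [e, mul_comm (∫ y, cauchyProfile y)]
  exact key

end Holder

/-! ### The moment of the Poisson kernel -/

/-- The radial profile `r^(d-1) (1 + r²)^(-(d+1)/2)` of the Poisson kernel in polar coordinates. -/
noncomputable def radialProfile (d : ℕ) (r : ℝ) : ℝ :=
  r ^ (d - 1) * (1 + r ^ 2) ^ (-((d : ℝ) + 1) / 2)

theorem radialProfile_nonneg (d : ℕ) {r : ℝ} (hr : 0 < r) : 0 ≤ radialProfile d r := by
  unfold radialProfile; positivity

theorem rpow_neg_half_eq (d : ℕ) (x : ℝ) (hx : 0 ≤ x) :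
    x ^ (-((d : ℝ) + 1) / 2) = ((√x) ^ (d + 1))⁻¹ := by
  rw [Real.sqrt_eq_rpow, ← Real.rpow_mul_natCast hx, ← Real.rpow_neg hx]
  congr 1
  push_cast
  ring

theorem radialProfile_le (hd : 1 ≤ d) {r : ℝ} (hr : 0 < r) : radialProfile d r ≤ (r ^ 2)⁻¹ := by
  rw [radialProfile, rpow_neg_half_eq _ _ (by positivity)]
  have h1 : r ≤ √(1 + r ^ 2) := Real.le_sqrt_of_sq_le (by linarith)
  calc r ^ (d - 1) * ((√(1 + r ^ 2)) ^ (d + 1))⁻¹ ≤ r ^ (d - 1) * (r ^ (d + 1))⁻¹ := by gcongr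
    _ = _ := by
      rw [show d + 1 = (d - 1) + 2 by omega, pow_add]
      field_simp

/-- For `r² > d` one has `(1 + r⁻²)^((d+1)/2) ≤ exp ((d + 1) / (2 d)) ≤ e`. -/
theorem exp_neg_one_div_sq_le_radialProfile (hd : 1 ≤ d) {r : ℝ} (hr : √d < r) :
    Real.exp (-1) * (r ^ 2)⁻¹ ≤ radialProfile d r := by
  have hr0 : 0 < r := (Real.sqrt_nonneg _).trans_lt hr
  have hd' : (1 : ℝ) ≤ d := by exact_mod_cast hd
  have hrd : (d : ℝ) ≤ r ^ 2 := ((Real.sqrt_lt' hr0).1 hr).le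
  have h1 : (1 + r ^ 2) ^ (((d : ℝ) + 1) / 2) ≤ Real.exp 1 * r ^ (d + 1) := by
    have e : r ^ (d + 1) = (r ^ 2) ^ (((d : ℝ) + 1) / 2) := by
      rw [← Real.rpow_natCast r 2, ← Real.rpow_mul hr0.le, ← Real.rpow_natCast]
      congr 1; push_cast; ring
    have h2 : 1 + r ^ 2 ≤ Real.exp ((r ^ 2)⁻¹) * r ^ 2 := by
      have := Real.add_one_le_exp ((r ^ 2)⁻¹)
      calc 1 + r ^ 2 = ((r ^ 2)⁻¹ + 1) * r ^ 2 := by field_simp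
        _ ≤ _ := by gcongr
    calc (1 + r ^ 2) ^ (((d : ℝ) + 1) / 2)
        ≤ (Real.exp ((r ^ 2)⁻¹) * r ^ 2) ^ (((d : ℝ) + 1) / 2) := by gcongr
      _ = Real.exp ((r ^ 2)⁻¹ * (((d : ℝ) + 1) / 2)) * r ^ (d + 1) := by
        rw [Real.mul_rpow (Real.exp_pos _).le (by positivity), ← Real.exp_mul, ← e]
      _ ≤ _ := by
        gcongr
        rw [inv_mul_le_iff₀ (by positivity)]
        linarith
  rw [radialProfile, show -((d : ℝ) + 1) / 2 = -(((d : ℝ) + 1) / 2) by ring,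
    Real.rpow_neg (by positivity), Real.exp_neg]
  have h3 : r ^ (d + 1) = r ^ (d - 1) * r ^ 2 := by rw [← pow_add]; congr 1; omega
  calc (Real.exp 1)⁻¹ * (r ^ 2)⁻¹ = r ^ (d - 1) * (Real.exp 1 * r ^ (d + 1))⁻¹ := by
        rw [h3]; field_simp
    _ ≤ _ := by gcongr

/-- The moment integral is cut at `R = e √d`: below `R` the factor `r^α` is at most `R^α`, and above
`R` the radial profile is at most `r⁻²`. This radius is large enough for the tail, `R^(α-1) / (1 - α)`,
to be controlled by the total mass `J`, because `J ≥ 1 / R`. -/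
theorem cauchyMoment_le (hd : 1 ≤ d) {α : ℝ} (hα : α ∈ Ioo (0 : ℝ) 1) :
    cauchyMoment d α ≤ (Real.exp 1 * √d) ^ α * ((2 - α) / (1 - α)) := by
  have hd' : (1 : ℝ) ≤ d := by exact_mod_cast hd
  have : Nonempty (Fin d) := ⟨⟨0, hd⟩⟩
  have hZ := integral_cauchyProfile_pos (d := d)
  have h1α : 0 < 1 - α := sub_pos.2 hα.2
  set R : ℝ := Real.exp 1 * √d with hR
  have hsd : 0 < √(d : ℝ) := Real.sqrt_pos.2 (by linarith)
  have hR0 : 0 < R := by positivity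
  have hZpolar := integral_fun_norm_addHaar (volume : Measure (EuclideanSpace ℝ (Fin d)))
    (fun r : ℝ => (1 + r ^ 2) ^ (-((d : ℝ) + 1) / 2))
  have hKpolar := integral_fun_norm_addHaar (volume : Measure (EuclideanSpace ℝ (Fin d)))
    (fun r : ℝ => (1 + r ^ 2) ^ (-((d : ℝ) + 1) / 2) * r ^ α)
  have hZint : IntegrableOn (radialProfile d) (Ioi 0) := by
    have := (integrable_fun_norm_addHaar (volume : Measure (EuclideanSpace ℝ (Fin d)))
      (f := fun r : ℝ => (1 + r ^ 2) ^ (-((d : ℝ) + 1) / 2))).1 integrable_cauchyProfile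
    rw [finrank_euclideanSpace_fin] at this
    exact this
  have hKint : IntegrableOn (fun r => radialProfile d r * r ^ α) (Ioi 0) := by
    have := (integrable_fun_norm_addHaar (volume : Measure (EuclideanSpace ℝ (Fin d)))
      (f := fun r : ℝ => (1 + r ^ 2) ^ (-((d : ℝ) + 1) / 2) * r ^ α)).1
        (integrable_cauchyProfile_mul_rpow hα)
    rw [finrank_euclideanSpace_fin] at this
    refine this.congr_fun (fun r _ => ?_) measurableSet_Ioi
    simp only [radialProfile, smul_eq_mul]
    ring
  set J := ∫ r in Ioi (0 : ℝ), radialProfile d r with hJ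
  set K := ∫ r in Ioi (0 : ℝ), radialProfile d r * r ^ α with hK
  have hJ1 : 1 ≤ R * J := by
    have hi : IntegrableOn (fun r : ℝ => Real.exp (-1) * r ^ (-2 : ℝ)) (Ioi √d) :=
      (integrableOn_Ioi_rpow_of_lt (by norm_num) hsd).const_mul _
    have h1 : ∫ r in Ioi √d, Real.exp (-1) * r ^ (-2 : ℝ) ≤ ∫ r in Ioi √d, radialProfile d r := by
      refine setIntegral_mono_on hi (hZint.mono_set (Ioi_subset_Ioi hsd.le)) measurableSet_Ioi
        fun r hr => ?_
      have hr0 : 0 < r := hsd.trans hr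
      rw [Real.rpow_neg hr0.le, Real.rpow_two]
      exact exp_neg_one_div_sq_le_radialProfile hd hr
    have h2 : ∫ r in Ioi √d, radialProfile d r ≤ J :=
      setIntegral_mono_set hZint
        ((ae_restrict_mem measurableSet_Ioi).mono fun r hr => radialProfile_nonneg d hr)
        (Ioi_subset_Ioi hsd.le).eventuallyLE
    rw [integral_const_mul, integral_Ioi_rpow_of_lt (by norm_num) hsd] at h1
    have h3 := h1.trans h2
    calc 1 = R * (Real.exp (-1) * (-√d ^ (-2 + 1 : ℝ) / (-2 + 1))) := by
          rw [show (-2 + 1 : ℝ) = -1 by norm_num, Real.rpow_neg_one, hR, Real.exp_neg]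
          field_simp
      _ ≤ R * J := by gcongr
  have hK1 : K ≤ R ^ α * J + R ^ (α - 1) / (1 - α) := by
    have hi : IntegrableOn (fun r : ℝ => r ^ (α - 2)) (Ioi R) :=
      integrableOn_Ioi_rpow_of_lt (by linarith [hα.2]) hR0
    have hi' : IntegrableOn ((Ioi R).indicator fun r : ℝ => r ^ (α - 2)) (Ioi 0) :=
      (hi.integrable_indicator measurableSet_Ioi).integrableOn
    have h1 : K ≤ ∫ r in Ioi (0 : ℝ),
        (R ^ α * radialProfile d r + (Ioi R).indicator (fun r : ℝ => r ^ (α - 2)) r) := by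
      refine setIntegral_mono_on hKint ((hZint.const_mul _).add hi') measurableSet_Ioi
        fun r hr => ?_
      have hr0 : 0 < r := hr
      have hP := radialProfile_nonneg d hr0
      by_cases hrR : r ∈ Ioi R
      · rw [indicator_of_mem hrR]
        have h2 : radialProfile d r * r ^ α ≤ r ^ (α - 2) := by
          calc radialProfile d r * r ^ α ≤ (r ^ 2)⁻¹ * r ^ α := by
                gcongr; exact radialProfile_le hd hr0
            _ = _ := by
              rw [Real.rpow_sub hr0, Real.rpow_two]; field_simp
        have : 0 ≤ R ^ α * radialProfile d r := by positivity
        linarith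
      · rw [indicator_of_notMem hrR, add_zero, mul_comm]
        gcongr
        · exact hα.1.le
        · exact not_lt.1 hrR
    refine h1.trans_eq ?_
    rw [integral_add (hZint.const_mul _) hi', integral_const_mul,
      setIntegral_indicator measurableSet_Ioi, Ioi_inter_Ioi, sup_eq_right.2 hR0.le,
      integral_Ioi_rpow_of_lt (by linarith [hα.2]) hR0, show α - 2 + 1 = -(1 - α) by ring,
      neg_div_neg_eq, neg_sub]
  have hKJ : K ≤ R ^ α * ((2 - α) / (1 - α)) * J := by
    refine hK1.trans ?_
    have h1 : R ^ (α - 1) ≤ R ^ α * J := by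
      rw [Real.rpow_sub_one hR0.ne', div_le_iff₀ hR0, mul_assoc, mul_comm J]
      exact le_mul_of_one_le_right (by positivity) hJ1
    calc R ^ α * J + R ^ (α - 1) / (1 - α) ≤ R ^ α * J + R ^ α * J / (1 - α) := by gcongr
      _ = _ := by field_simp; ring
  rw [cauchyMoment, inv_mul_le_iff₀ hZ]
  rw [finrank_euclideanSpace_fin] at hZpolar hKpolar
  have e1 : ∫ y : EuclideanSpace ℝ (Fin d), cauchyProfile y =
      d • volume.real (Metric.ball (0 : EuclideanSpace ℝ (Fin d)) 1) • J := hZpolar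
  have e2 : ∫ y : EuclideanSpace ℝ (Fin d), cauchyProfile y * ‖y‖ ^ α =
      d • volume.real (Metric.ball (0 : EuclideanSpace ℝ (Fin d)) 1) • K := by
    refine hKpolar.trans ?_
    rw [hK]
    congr 3
    ext r
    simp only [radialProfile, smul_eq_mul]
    ring
  rw [e1, e2]
  simp only [smul_eq_mul, nsmul_eq_mul]
  calc _ ≤ (d : ℝ) * (volume.real (Metric.ball (0 : EuclideanSpace ℝ (Fin d)) 1) *
        (R ^ α * ((2 - α) / (1 - α)) * J)) := by gcongr
    _ = _ := by ring

/-- The constant of the normal derivative estimate. -/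
theorem two_sub_mul_cauchyMoment_le (hd : 1 ≤ d) {α : ℝ} (hα : α ∈ Ioo (0 : ℝ) 1) :
    (2 - α) * cauchyMoment d α ≤ 4 * √d / (1 - α) := by
  obtain ⟨h0, h1⟩ := hα
  have h1α : 0 < 1 - α := sub_pos.2 h1
  have hd1 : 1 ≤ √(d : ℝ) := by
    rw [Real.one_le_sqrt]; exact_mod_cast hd
  have hmom := cauchyMoment_le hd ⟨h0, h1⟩
  have hpow : √(d : ℝ) ^ α ≤ √d := by
    simpa using Real.rpow_le_rpow_of_exponent_le hd1 h1.le
  -- `(2 - α)² e^α ≤ 4`, since `1 - α/2 ≤ e^(-α/2)`.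
  have hexp : (2 - α) ^ 2 * Real.exp α ≤ 4 := by
    have h2 := Real.one_sub_le_exp_neg (α / 2)
    have h3 : (1 - α / 2) ^ 2 ≤ Real.exp (-(α / 2)) ^ 2 := by
      gcongr
      linarith
    rw [← Real.exp_nat_mul, show ((2 : ℕ) : ℝ) * -(α / 2) = -α by push_cast; ring,
      Real.exp_neg] at h3
    have h4 := mul_le_mul_of_nonneg_right h3 (Real.exp_pos α).le
    rw [inv_mul_cancel₀ (Real.exp_pos α).ne'] at h4
    nlinarith
  rw [Real.mul_rpow (Real.exp_pos 1).le (Real.sqrt_nonneg _), Real.exp_one_rpow] at hmom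
  calc (2 - α) * cauchyMoment d α
      ≤ (2 - α) * (Real.exp α * √d ^ α * ((2 - α) / (1 - α))) := by
        have : 0 ≤ 2 - α := by linarith
        gcongr
    _ = ((2 - α) ^ 2 * Real.exp α) * √d ^ α / (1 - α) := by field_simp
    _ ≤ _ := by gcongr

/-! ### From increments to derivatives -/

/-- A one-sided bound for the increments of `u` by a function vanishing at `0` bounds the derivative. -/
theorem abs_le_of_abs_sub_le_of_hasDerivAt {u φ : ℝ → ℝ} {u' φ' : ℝ} (hu : HasDerivAt u u' 0)
    (hφ : HasDerivAt φ φ' 0) (hφ0 : φ 0 = 0) (h : ∀ᶠ r in 𝓝[>] 0, |u r - u 0| ≤ φ r) :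
    |u'| ≤ φ' := by
  refine le_of_tendsto_of_tendsto hu.tendsto_slope_zero_right.abs hφ.tendsto_slope_zero_right ?_
  filter_upwards [h, self_mem_nhdsWithin] with r hr hr0
  have hr0' : (0 : ℝ) < r := hr0
  simp only [zero_add, smul_eq_mul, abs_mul, abs_of_pos (inv_pos.2 hr0'), hφ0, sub_zero]
  gcongr

section Derivative

variable {U : EuclideanSpace ℝ (Fin (d + 1)) → ℝ} {x' : EuclideanSpace ℝ (Fin d)} {t K α : ℝ}

theorem abs_fderiv_normal_le (ht : 0 < t) (hd : DifferentiableAt ℝ U (point x' t))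
    (h : ∀ s, 0 < s → s < t →
      |U (point x' t) - U (point x' s)| ≤ K * ((2 * t / s - 1) * s ^ α - t ^ α)) :
    |fderiv ℝ U (point x' t) (point 0 1)| ≤ K * ((2 - α) * t ^ (α - 1)) := by
  have hpt : ∀ r : ℝ, point x' t + r • (-point 0 1) = point x' (t - r) := fun r => by
    rw [smul_neg, ← sub_eq_add_neg, sub_eq_iff_eq_add, ← point_smul, ← point_add]
    simp
  have hline : HasDerivAt (fun r : ℝ => point x' t + r • (-point (0 : EuclideanSpace ℝ (Fin d)) 1))
      (-point 0 1) 0 := by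
    simpa using ((hasDerivAt_id (0 : ℝ)).smul_const
      (-point (0 : EuclideanSpace ℝ (Fin d)) 1)).const_add (point x' t)
  have hd' : HasFDerivAt U (fderiv ℝ U (point x' t))
      (point x' t + (0 : ℝ) • (-point (0 : EuclideanSpace ℝ (Fin d)) 1)) := by
    simpa using hd.hasFDerivAt
  have hu := hd'.comp_hasDerivAt (0 : ℝ) hline
  have hw : HasDerivAt (fun r : ℝ => t - r) (-1) 0 := by
    simpa using (hasDerivAt_id (0 : ℝ)).const_sub t
  have ht0 : t - 0 ≠ 0 := by simpa using ht.ne'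
  have hφ : HasDerivAt (fun r : ℝ => K * ((2 * t / (t - r) - 1) * (t - r) ^ α - t ^ α))
      (K * ((2 - α) * t ^ (α - 1))) 0 := by
    have h1 := ((((hasDerivAt_const (0 : ℝ) (2 * t)).div hw ht0).sub_const 1).mul
      (hw.rpow_const (p := α) (Or.inl ht0))).sub_const (t ^ α) |>.const_mul K
    refine h1.congr_deriv ?_
    simp only [sub_zero, Pi.div_apply, Real.rpow_sub_one ht.ne']
    field_simp
    ring
  have := abs_le_of_abs_sub_le_of_hasDerivAt hu hφ (by
    simp only [sub_zero]; field_simp; ring) ?_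
  · simpa using this
  · filter_upwards [Ioo_mem_nhdsGT ht] with r hr
    simp only [Function.comp_apply, hpt, sub_zero]
    rw [abs_sub_comm]
    exact h _ (sub_pos.2 hr.2) (by linarith [hr.1])

theorem abs_fderiv_tangential_le (ht : 0 < t) (hd : DifferentiableAt ℝ U (point x' t))
    (h : ∀ p : EuclideanSpace ℝ (Fin d), ‖p‖ < t → |U (point (x' + p) t) - U (point x' t)| ≤
      (d + 1) * ‖p‖ * ((1 - ‖p‖ / t) ^ (d + 1))⁻¹ * K) (p : EuclideanSpace ℝ (Fin d)) :
    |fderiv ℝ U (point x' t) (point p 0)| ≤ (d + 1) * K * ‖p‖ := by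
  have hpt : ∀ r : ℝ, point x' t + r • point p 0 = point (x' + r • p) t := fun r => by
    rw [← point_smul, ← point_add]; simp
  have hline : HasDerivAt (fun r : ℝ => point x' t + r • point p 0) (point p 0) 0 := by
    simpa using ((hasDerivAt_id (0 : ℝ)).smul_const (point p 0)).const_add (point x' t)
  have hd' : HasFDerivAt U (fderiv ℝ U (point x' t)) (point x' t + (0 : ℝ) • point p 0) := by
    simpa using hd.hasFDerivAt
  have hu := hd'.comp_hasDerivAt (0 : ℝ) hline
  have hφ : HasDerivAt
      (fun r : ℝ => r * ((d + 1) * ‖p‖ * ((1 - r * ‖p‖ / t) ^ (d + 1))⁻¹ * K))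
      ((d + 1) * K * ‖p‖) 0 := by
    have hg : DifferentiableAt ℝ
        (fun r : ℝ => (d + 1) * ‖p‖ * ((1 - r * ‖p‖ / t) ^ (d + 1))⁻¹ * K) 0 := by
      refine ((DifferentiableAt.inv (by fun_prop) (by simp)).const_mul _).mul_const K
    refine ((hasDerivAt_id (0 : ℝ)).mul hg.hasDerivAt).congr_deriv ?_
    simp
    ring
  refine abs_le_of_abs_sub_le_of_hasDerivAt hu hφ (by simp) ?_
  have hsmall : ∀ᶠ r : ℝ in 𝓝 0, r * ‖p‖ < t := by
    have : ContinuousAt (fun r : ℝ => r * ‖p‖) 0 := by fun_prop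
    exact this.eventually (gt_mem_nhds (by simpa using ht))
  filter_upwards [nhdsWithin_le_nhds hsmall, self_mem_nhdsWithin] with r hr hr0
  have hr0' : (0 : ℝ) < r := hr0
  have hnorm : ‖r • p‖ = r * ‖p‖ := by rw [norm_smul, Real.norm_of_nonneg hr0'.le]
  have := h (r • p) (by rwa [hnorm])
  rw [hnorm] at this
  simp only [Function.comp_apply, hpt, zero_smul, add_zero]
  refine this.trans_eq ?_
  ring

theorem norm_gradient_le {A B : ℝ} (hA0 : 0 ≤ A) (hB0 : 0 ≤ B) {x : EuclideanSpace ℝ (Fin (d + 1))}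
    (hA : |fderiv ℝ U x (point 0 1)| ≤ A) (hB : ∀ p, |fderiv ℝ U x (point p 0)| ≤ B * ‖p‖) :
    ‖∇ U x‖ ≤ A + B := by
  set v := ∇ U x with hv
  have hin : ∀ w, inner ℝ v w = fderiv ℝ U x w := fun w => by
    rw [hv, gradient, toDual_symm_apply]
  have hsplit : v = point (tangential v) 0 + v (Fin.last d) • point 0 1 := by
    rw [← point_smul, ← point_add]; simp
  have h1 : ‖v‖ ^ 2 = fderiv ℝ U x (point (tangential v) 0) +
      v (Fin.last d) * fderiv ℝ U x (point 0 1) := by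
    rw [← real_inner_self_eq_norm_sq, hin]
    conv_lhs => rw [hsplit]
    simp
  have h2 : ‖tangential v‖ ≤ ‖v‖ := by
    refine abs_le_of_sq_le_sq' ?_ (norm_nonneg _) |>.2
    rw [norm_sq_eq v]
    nlinarith [sq_nonneg (v (Fin.last d))]
  have h3 : |v (Fin.last d)| ≤ ‖v‖ := PiLp.norm_apply_le v _
  have h4 : ‖v‖ ^ 2 ≤ (A + B) * ‖v‖ := by
    rw [h1]
    calc _ ≤ |fderiv ℝ U x (point (tangential v) 0)| +
          |v (Fin.last d)| * |fderiv ℝ U x (point 0 1)| := by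
          rw [← abs_mul]; exact add_le_add (le_abs_self _) (le_abs_self _)
      _ ≤ B * ‖v‖ + ‖v‖ * A := by
          refine add_le_add ((hB _).trans (by gcongr)) ?_
          gcongr
      _ = _ := by ring
  rcases (norm_nonneg v).eq_or_lt with h | h
  · rw [← h]; positivity
  · rw [sq] at h4
    exact le_of_mul_le_mul_right h4 h

end Derivative

end HalfSpace

/-! ### The gradient and Hölder estimates -/

open HalfSpace in
/-- Here the dimension of the space is `n = d + 1 ≥ 2`. -/
theorem mainTheorem2 (d : ℕ) (hd : 2 ≤ d + 1) (α : ℝ) (hα : α ∈ Set.Ioo (0 : ℝ) 1)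
    (U : EuclideanSpace ℝ (Fin (d + 1)) → ℝ)
    (hharm : InnerProductSpace.HarmonicOnNhd U (HalfSpace.upperHalfSpace d))
    (hbdd : ∃ M : ℝ, ∀ x ∈ HalfSpace.upperHalfSpace d, |U x| ≤ M)
    (hcont : ContinuousOn U (closure (HalfSpace.upperHalfSpace d)))
    (C : ℝ)
    (hbdry : ∀ x' y' : EuclideanSpace ℝ (Fin d),
      |U (HalfSpace.point x' 0) - U (HalfSpace.point y' 0)| ≤ C * ‖x' - y'‖ ^ α) :
    (∀ (x' : EuclideanSpace ℝ (Fin d)) (t : ℝ), 0 < t →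
      |deriv (fun s : ℝ => U (HalfSpace.point x' s)) t| ≤
        4 * (((d + 1 : ℕ) : ℝ) - 1) ^ (1 / 2 : ℝ) / (1 - α) * C * t ^ (α - 1)) ∧
    (∀ (x' : EuclideanSpace ℝ (Fin d)) (t : ℝ), 0 < t →
      ‖∇ U (HalfSpace.point x' t)‖ ≤
        16 * (((d + 1 : ℕ) : ℝ) + 1) / (1 - α) ^ 2 * C * t ^ (α - 1)) ∧
    HalfSpace.MemLipschitzClass α (HalfSpace.upperHalfSpace d) U ∧
    (∀ x ∈ HalfSpace.upperHalfSpace d, ∀ y ∈ HalfSpace.upperHalfSpace d,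
      |U x - U y| ≤
        64 * (((d + 1 : ℕ) : ℝ) + 1) / (α * (1 - α) ^ 2) * C * ‖x - y‖ ^ α) := by
  obtain ⟨hα0, hα1⟩ := id hα
  have hd1 : 1 ≤ d := by omega
  have hd' : (1 : ℝ) ≤ d := by exact_mod_cast hd1
  have h1α : 0 < 1 - α := sub_pos.2 hα1
  obtain ⟨M, hM⟩ := hbdd
  have hMcl : ∀ x ∈ closure (upperHalfSpace d), |U x| ≤ M := by
    intro x hx
    have h1 : U x ∈ closure (U '' upperHalfSpace d) := hcont.image_closure ⟨x, hx, rfl⟩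
    have h2 : closure (U '' upperHalfSpace d) ⊆ Set.Icc (-M) M := by
      refine closure_minimal ?_ isClosed_Icc
      rintro _ ⟨y, hy, rfl⟩
      exact abs_le.1 (hM y hy)
    exact abs_le.2 (h2 h1)
  -- There are two boundary points at distance one, so `C` cannot be negative.
  have hC : 0 ≤ C := by
    have h := hbdry (EuclideanSpace.single ⟨0, hd1⟩ 1) 0
    simp only [sub_zero, PiLp.norm_single, norm_one, Real.one_rpow, mul_one] at h
    exact (abs_nonneg _).trans h
  set f : EuclideanSpace ℝ (Fin d) → ℝ := fun y => U (point y 0) with hf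
  have hfc : Continuous f :=
    hcont.comp_continuous continuous_point_zero fun y => by rw [closure_upperHalfSpace]; simp
  have hfM : ∀ y, |f y| ≤ M := fun y => hMcl _ (by rw [closure_upperHalfSpace]; simp)
  have hUF : ∀ x ∈ upperHalfSpace d, U x = poissonIntegral f x := fun x hx =>
    eq_poissonIntegral hharm hcont hMcl hx
  have hmem : ∀ (x' : EuclideanSpace ℝ (Fin d)) {t : ℝ}, 0 < t →
      point x' t ∈ upperHalfSpace d := fun x' t ht => by simpa [upperHalfSpace] using ht
  have hdiff : ∀ (x' : EuclideanSpace ℝ (Fin d)) {t : ℝ}, 0 < t →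
      DifferentiableAt ℝ U (point x' t) := fun x' t ht =>
    (hharm _ (hmem x' ht)).1.differentiableAt (by norm_num)
  have hmom := two_sub_mul_cauchyMoment_le hd1 hα
  have hκ := cauchyMoment_nonneg d α
  have hnormal : ∀ (x' : EuclideanSpace ℝ (Fin d)) {t : ℝ}, 0 < t →
      |fderiv ℝ U (point x' t) (point 0 1)| ≤ 4 * √d / (1 - α) * C * t ^ (α - 1) := by
    intro x' t ht
    have h := abs_fderiv_normal_le (K := C * cauchyMoment d α) (α := α) ht (hdiff x' ht)
      fun s hs hst => by
        rw [hUF _ (hmem x' ht), hUF _ (hmem x' hs)]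
        exact abs_poissonIntegral_normal_sub_le hfc hfM hα hbdry x' hs hst
    calc _ ≤ (2 - α) * cauchyMoment d α * C * t ^ (α - 1) := h.trans_eq (by ring)
      _ ≤ _ := by gcongr
  have hsqrt : √(d : ℝ) ≤ d := by
    rw [Real.sqrt_le_left (by linarith)]
    nlinarith
  have hsq : (1 - α) ^ 2 ≤ 1 - α := by nlinarith
  have hsq1 : (1 - α) ^ 2 ≤ 1 := by nlinarith
  have hq : 4 * √d / (1 - α) ≤ 4 * d / (1 - α) ^ 2 := by gcongr
  have hq1 : ((d : ℝ) + 1) ≤ (d + 1) / (1 - α) ^ 2 := by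
    rw [le_div_iff₀ (by positivity)]
    exact mul_le_of_le_one_right (by positivity) hsq1
  have hholder : ∀ x ∈ upperHalfSpace d, ∀ y ∈ upperHalfSpace d,
      |U x - U y| ≤ 64 * (((d + 1 : ℕ) : ℝ) + 1) / (α * (1 - α) ^ 2) * C * ‖x - y‖ ^ α := by
    intro x hx y hy
    rw [hUF x hx, hUF y hy]
    have h1 := abs_poissonIntegral_sub_le hfc hfM hα hC hbdry x y
    have h2 : ‖tangential x - tangential y‖ ≤ ‖x - y‖ := by
      rw [← tangential_sub]
      refine abs_le_of_sq_le_sq' ?_ (norm_nonneg _) |>.2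
      rw [norm_sq_eq (x - y)]
      nlinarith [sq_nonneg ((x - y) (Fin.last d))]
    have h3 : |x (Fin.last d) - y (Fin.last d)| ≤ ‖x - y‖ := PiLp.norm_apply_le (x - y) _
    have hc : 1 + cauchyMoment d α ≤ 64 * (((d + 1 : ℕ) : ℝ) + 1) / (α * (1 - α) ^ 2) := by
      have h4 : cauchyMoment d α ≤ (2 - α) * cauchyMoment d α :=
        le_mul_of_one_le_left hκ (by linarith)
      have h5 : 64 * (((d + 1 : ℕ) : ℝ) + 1) / (1 - α) ^ 2 ≤
          64 * (((d + 1 : ℕ) : ℝ) + 1) / (α * (1 - α) ^ 2) := by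
        gcongr
        exact mul_le_of_le_one_left (by positivity) hα1.le
      have h6 : (d + 1) / (1 - α) ^ 2 + 4 * d / (1 - α) ^ 2 ≤
          64 * (((d + 1 : ℕ) : ℝ) + 1) / (1 - α) ^ 2 := by
        rw [← add_div]
        push_cast
        gcongr
        linarith
      linarith
    calc _ ≤ C * ‖x - y‖ ^ α + C * cauchyMoment d α * ‖x - y‖ ^ α := by
          refine h1.trans ?_
          gcongr
      _ = (1 + cauchyMoment d α) * C * ‖x - y‖ ^ α := by ring
      _ ≤ _ := by gcongr
  refine ⟨fun x' t ht => ?_, fun x' t ht => ?_, ⟨_, hholder⟩, hholder⟩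
  · have hline : HasDerivAt (fun s : ℝ => point x' s) (point 0 1) t := by
      have h : (fun s : ℝ => point x' s) = fun s : ℝ => point x' 0 + s • point 0 1 := by
        ext1 s
        rw [← point_smul, ← point_add]; simp
      rw [h]
      simpa using ((hasDerivAt_id t).smul_const
        (point (0 : EuclideanSpace ℝ (Fin d)) 1)).const_add (point x' 0)
    have hU := ((hdiff x' ht).hasFDerivAt.comp_hasDerivAt t hline).deriv
    have hU' : deriv (fun s : ℝ => U (point x' s)) t = fderiv ℝ U (point x' t) (point 0 1) := hU
    have hroot : (((d + 1 : ℕ) : ℝ) - 1) ^ (1 / 2 : ℝ) = √d := by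
      rw [Real.sqrt_eq_rpow]; push_cast; ring_nf
    rw [hU', hroot]
    exact hnormal x' ht
  · have htang := abs_fderiv_tangential_le (K := C * t ^ (α - 1)) ht (hdiff x' ht) fun p hp => by
      rw [hUF _ (hmem _ ht), hUF _ (hmem _ ht)]
      exact abs_poissonIntegral_tangential_sub_le hfc hfM hα hbdry hC x' p hp
    refine (norm_gradient_le (by positivity) (by positivity) (hnormal x' ht) htang).trans ?_
    have h6 : 4 * √d / (1 - α) + (d + 1) ≤ 16 * (((d + 1 : ℕ) : ℝ) + 1) / (1 - α) ^ 2 := by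
      refine (add_le_add hq hq1).trans ?_
      rw [← add_div]
      push_cast
      gcongr
      linarith
    calc _ = (4 * √d / (1 - α) + (d + 1)) * C * t ^ (α - 1) := by ring
      _ ≤ _ := by gcongr
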